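/- Let $m\ge 2$ and let $\mathbb{R}^m$ carry the Euclidean metric $g=(dx^1)^2+\dots+(dx^m)^2$ and the standard orientation. Let $J^r=J^r(\mathbb{R},\mathbb{R}^m)$ be the manifold of $r$-jets $j^r_t\sigma$ of curves, with coordinates $(t,x_0,\dots,x_r)$, $x_k(j^r_t\sigma)=\sigma^{(k)}(t)\in\mathbb{R}^m$, and let $\pi^r_l\colon J^r\to J^l$ be the projections. Each Killing vector field $X$ of $g$ has a flow $\phi_s$, and $X^{(r)}$ denotes the vector field on $J^r$ generating the prolonged flow $j^r_t\sigma\mapsto j^r_t(\phi_s\circ\sigma)$; let $\mathfrak{D}^r_\xi\subset T_\xi J^r$ be the span of the vectors $X^{(r)}_\xi$. A differential invariant of order $r$ on an open set $U\subseteq J^r$ is a smooth function $f$ on $U$ with $X^{(r)}f=0$ for every Killing field $X$. A jet $j^{m-1}_t\sigma$ is a Frenet jet if $\sigma'(t),\dots,\sigma^{(m-1)}(t)$ are linearly independent; $\mathcal{F}^{m-1}\subset J^{m-1}$ is the open set of Frenet jets. On $(\pi^m_{m-1})^{-1}\mathcal{F}^{m-1}\subset J^m$ let $\varkappa_i(j^m_t\sigma)=\kappa^\sigma_i(t)$,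 $0\le i\le m-1$, where $\kappa_0^\sigma,\dots,\kappa_{m-1}^\sigma$ are the curvatures of the Frenet curve $\sigma$, that is, the functions with $\kappa_j^\sigma>0$ for $j\le m-2$ such that $\sigma'=\kappa_0^\sigma X_1$ and $$\tfrac{1}{\kappa_0^\sigma}X_1'=\kappa_1^\sigma X_2,\qquad \tfrac1{\kappa_0^\sigma}X_i'=-\kappa_{i-1}^\sigma X_{i-1}+\kappa_i^\sigma X_{i+1}\ (2\le i\le m-1),\qquad \tfrac1{\kappa_0^\sigma}X_m'=-\kappa_{m-1}^\sigma X_{m-1},$$ for the positively oriented orthonormal frame $(X_1,\dots,X_m)$ along $\sigma$ for which $(X_1,\dots,X_i)$ and $(\sigma',\dots,\sigma^{(i)})$ span the same subspace with the same orientation, $1\le i\le m-1$. Finally, let $D_t=\partial/\partial t+\sum_{k\ge0}\sum_i x^i_{k+1}\,\partial/\partial x^i_k$ be the total derivative. Then: (1) If $\sigma$ is a smooth curve such that $j^{m-1}_{t_0}\sigma$ is a Frenet jet, then $$\dim\mathfrak{D}^r_{j^r_{t_0}\sigma}=\begin{cases} m+\tfrac12(2m-r-1)r, & 1\le r\le m-1,\\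 m+\binom m2, & r\ge m.\end{cases}$$ (2) For $r\ge1$ let $N_r$ be the maximal number of functionally independent differential invariants of order $r$ (functionally independent meaning that their differentials are linearly independent on a dense open subset). This maximum exists, it is the same for invariants defined on all of $J^r$ and for invariants defined on any given non-empty open subset of $J^r$, and $$N_r=\begin{cases}1+\binom{r+1}2, & 1\le r\le m-1,\\ 1+\tfrac12 m(2r-m+1), & r\ge m.\end{cases}$$ (3) For $h,i\ge0$ with $h+i\le m-1$ the function $D_t^h\varkappa_i$ is of order at most $m$, i.e. it is a function on $(\pi^m_{m-1})^{-1}\mathcal{F}^{m-1}\subset J^m$, and the functions $t$ and $D_t^h\varkappa_i$, $h+i\le m-1$, are a basis of the differential invariants of order at most $m$ there: they are differential invariants, their differentials are linearly independent at every point of $(\pi^m_{m-1})^{-1}\mathcal{F}^{m-1}$, and every point of this set has arbitrarily small open neighbourhoods $N$ such that every differential invariant on $N$ is a smooth function of them. -/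

import Mathlib

open Set
open scoped ContDiff

noncomputable section

namespace EuclideanJets

/-- Euclidean space `ℝ^m` with the metric `(dx¹)² + ⋯ + (dx^m)²`. -/
abbrev E (m : ℕ) : Type := EuclideanSpace ℝ (Fin m)

/-- The jet manifold `J^r(ℝ, ℝ^m)` in its standard global coordinates `(t, x_0, x_1, …, x_r)`:
a point is an `r`-jet `j^r_t σ`, where `x_k` is the `k`-th derivative of `σ` at `t`. -/
abbrev Jet (m r : ℕ) : Type := ℝ × (Fin (r + 1) → E m)

variable {m r : ℕ}

/-- The jet `j^r_t σ`. -/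
def jet (r : ℕ) (σ : ℝ → E m) (t : ℝ) : Jet m r :=
  (t, fun k => iteratedDeriv (k : ℕ) σ t)

/-- The polynomial curve of degree at most `r` whose `r`-jet at `ξ.1` is `ξ`. -/
def taylorCurve (ξ : Jet m r) (s : ℝ) : E m :=
  ∑ k : Fin (r + 1), ((s - ξ.1) ^ (k : ℕ) / (Nat.factorial k : ℝ)) • ξ.2 k

/-- The canonical projection `J^r → J^l`, `l ≤ r`. -/
def proj {l r : ℕ} (h : l ≤ r) (ξ : Jet m r) : Jet m l :=
  (ξ.1, fun k => ξ.2 (Fin.castLE (Nat.succ_le_succ h) k))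

/-! ### Prolongation of Killing fields -/

/-- The jet prolongation `φ^{(r)}(j^r_t σ) = j^r_t (φ ∘ σ)` of a map `φ`. -/
def prolong (r : ℕ) (φ : E m → E m) (ξ : Jet m r) : Jet m r :=
  jet r (φ ∘ taylorCurve ξ) ξ.1

/-- Smooth Killing vector fields of the Euclidean metric: `L_X g = 0`. -/
def IsKilling (X : E m → E m) : Prop :=
  ContDiff ℝ ∞ X ∧
    ∀ x u v : E m, inner ℝ (fderiv ℝ X x u) v + inner ℝ u (fderiv ℝ X x v) = 0

/-- `φ` is the (global) flow of the vector field `X`. -/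
def IsFlow (X : E m → E m) (φ : ℝ → E m → E m) : Prop :=
  (∀ x, φ 0 x = x) ∧ ∀ s x, HasDerivAt (fun s' => φ s' x) (X (φ s x)) s

/-- `V` is the value at `ξ` of the prolonged vector field `X^{(r)}`, the infinitesimal generator
of the prolonged flow of `X`. -/
def IsProlongedVector (X : E m → E m) (ξ V : Jet m r) : Prop :=
  ∃ φ : ℝ → E m → E m, IsFlow X φ ∧ HasDerivAt (fun s => prolong r (φ s) ξ) V 0

/-- The fibre at `ξ` of the distribution `𝔇^r` spanned by the prolonged Killing fields. -/
def killingDistribution (ξ : Jet m r) : Submodule ℝ (Jet m r) :=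
  Submodule.span ℝ {V | ∃ X : E m → E m, IsKilling X ∧ IsProlongedVector X ξ V}

/-! ### Differential invariants -/

/-- Differential invariants of order `r` on an open set `U ⊆ J^r`: smooth first integrals
of the distribution `𝔇^r`. -/
def IsDifferentialInvariantOn (U : Set (Jet m r)) (f : Jet m r → ℝ) : Prop :=
  ContDiffOn ℝ ∞ f U ∧ ∀ ξ ∈ U, ∀ V ∈ killingDistribution ξ, fderiv ℝ f ξ V = 0

/-- The differentials of the family `f` are linearly independent at every point of `U`. -/
def FunctionallyIndependentOn {ι : Type} (U : Set (Jet m r)) (f : ι → Jet m r → ℝ) : Prop :=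
  ∀ ξ ∈ U, LinearIndependent ℝ (fun i => fderiv ℝ (f i) ξ)

/-- `N` is the maximal number of (generically) functionally independent differential invariants
of order `r`, both for globally defined invariants (`U = univ`) and for invariants that are only
defined on some non-empty open subset `U` of `J^r(ℝ, ℝ^m)`. -/
def IsNumberOfInvariants (m r N : ℕ) : Prop :=
  ∀ U : Set (Jet m r), IsOpen U → U.Nonempty →
    IsGreatest {k : ℕ | ∃ f : Fin k → Jet m r → ℝ,
      (∀ i, IsDifferentialInvariantOn U (f i)) ∧
      ∃ O : Set (Jet m r), IsOpen O ∧ O ⊆ U ∧ U ⊆ closure O ∧ FunctionallyIndependentOn O f} N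

/-- A basis of the differential invariants of order `r` on the open set `Ω`: a functionally
independent family of differential invariants such that every point of `Ω` has arbitrarily small
open neighbourhoods `N` on which every differential invariant is a smooth function of the
family. -/
def IsBasisOfInvariantsOn {ι : Type} [Fintype ι] (Ω : Set (Jet m r))
    (I : ι → Jet m r → ℝ) : Prop :=
  (∀ a, IsDifferentialInvariantOn Ω (I a)) ∧
  FunctionallyIndependentOn Ω I ∧
  ∀ ξ ∈ Ω, ∀ U : Set (Jet m r), IsOpen U → ξ ∈ U →
    ∃ N : Set (Jet m r), IsOpen N ∧ ξ ∈ N ∧ N ⊆ U ∩ Ω ∧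
      ∀ f : Jet m r → ℝ, IsDifferentialInvariantOn N f →
        ∃ (W : Set (ι → ℝ)) (F : (ι → ℝ) → ℝ),
          IsOpen W ∧ (∀ η ∈ N, (fun a => I a η) ∈ W) ∧ ContDiffOn ℝ ∞ F W ∧
          ∀ η ∈ N, f η = F (fun a => I a η)

/-- The total derivative `D_t = ∂/∂t + ∑ x_{k+1}^i ∂/∂x_k^i`, from functions on `J^r` to functions
on `J^{r+1}`. -/
def totalDeriv (f : Jet m r → ℝ) (ξ : Jet m (r + 1)) : ℝ :=
  fderiv ℝ f (proj (Nat.le_succ r) ξ) (1, fun k => ξ.2 k.succ)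

/-- The iterated total derivative `D_t^h`. -/
def iterTotalDeriv (f : Jet m r → ℝ) : (h : ℕ) → Jet m (r + h) → ℝ
  | 0 => f
  | h + 1 => totalDeriv (iterTotalDeriv f h)

/-! ### Frenet curves and their curvatures

The Levi-Civita connection is flat, so that the iterated covariant derivative
`∇_T^{k-1} T` of the tangent field `T` of `σ` is the ordinary `k`-th derivative of `σ`. -/

/-- `σ` is in general position up to the order `m - 1` at `t`. -/
def IsFrenetAt (σ : ℝ → E m) (t : ℝ) : Prop :=
  LinearIndependent ℝ (fun k : Fin (m - 1) => iteratedDeriv ((k : ℕ) + 1) σ t)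

/-- Smooth Frenet curves `σ : (a,b) → ℝ^m`. -/
def IsFrenetCurve (σ : ℝ → E m) (a b : ℝ) : Prop :=
  ContDiffOn ℝ ∞ σ (Ioo a b) ∧ ∀ t ∈ Ioo a b, IsFrenetAt σ t

/-- The set `(π^r_{m-1})⁻¹ 𝓕^{m-1} ⊆ J^r`, `r ≥ m - 1`, of the jets that lie over Frenet jets. -/
def frenetJets (m r : ℕ) (h : m ≤ r + 1) : Set (Jet m r) :=
  {ξ | LinearIndependent ℝ
    (fun k : Fin (m - 1) => ξ.2 ⟨(k : ℕ) + 1, by have := k.isLt; omega⟩)}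

/-- `X_1, …, X_m` is the Frenet frame of the Frenet curve `σ : (a,b) → ℝ^m` (`m ≥ 2`), and
`κ_0, …, κ_{m-1}` are its curvatures; values at other indices play no role. Since
`T = κ_0 X_1`, the covariant derivative `∇_{X_1}` along `σ` is `κ_0⁻¹ d/dt`. -/
structure IsFrenetFrame (σ : ℝ → E m) (a b : ℝ) (X : ℕ → ℝ → E m) (κ : ℕ → ℝ → ℝ) : Prop where
  smooth_frame : ∀ i, 1 ≤ i → i ≤ m → ContDiffOn ℝ ∞ (X i) (Ioo a b)
  smooth_curvature : ∀ i, i ≤ m - 1 → ContDiffOn ℝ ∞ (κ i) (Ioo a b)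
  curvature_pos : ∀ j, j ≤ m - 2 → ∀ t ∈ Ioo a b, 0 < κ j t
  orthonormal : ∀ t ∈ Ioo a b, Orthonormal ℝ (fun i : Fin m => X ((i : ℕ) + 1) t)
  positively_oriented : ∀ t ∈ Ioo a b,
    0 < (Matrix.of fun i j : Fin m => X ((j : ℕ) + 1) t i).det
  same_span : ∀ n, 1 ≤ n → n ≤ m - 1 → ∀ t ∈ Ioo a b,
    Submodule.span ℝ (range fun j : Fin n => X ((j : ℕ) + 1) t) =
      Submodule.span ℝ (range fun j : Fin n => iteratedDeriv ((j : ℕ) + 1) σ t)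
  /-- The two bases of this subspace are equally oriented: the determinant of the
  coefficients of the second one in the orthonormal first one is positive. -/
  same_orientation : ∀ n, 1 ≤ n → n ≤ m - 1 → ∀ t ∈ Ioo a b,
    0 < (Matrix.of fun i j : Fin n =>
      inner ℝ (X ((i : ℕ) + 1) t) (iteratedDeriv ((j : ℕ) + 1) σ t)).det
  tangent : ∀ t ∈ Ioo a b, deriv σ t = κ 0 t • X 1 t
  frenet_first : ∀ t ∈ Ioo a b, (κ 0 t)⁻¹ • deriv (X 1) t = κ 1 t • X 2 t
  frenet_middle : ∀ i, 2 ≤ i → i ≤ m - 1 → ∀ t ∈ Ioo a b,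
    (κ 0 t)⁻¹ • deriv (X i) t = -(κ (i - 1) t • X (i - 1) t) + κ i t • X (i + 1) t
  frenet_last : ∀ t ∈ Ioo a b,
    (κ 0 t)⁻¹ • deriv (X m) t = -(κ (m - 1) t • X (m - 1) t)

/-- `c` is the value at `t` of the curvature `κ_i` of a Frenet curve `σ` with `j^m_t σ = ξ`. -/
def IsCurvatureAt (i : ℕ) (ξ : Jet m m) (c : ℝ) : Prop :=
  ∃ (σ : ℝ → E m) (a b : ℝ) (X : ℕ → ℝ → E m) (κ : ℕ → ℝ → ℝ),
    ξ.1 ∈ Ioo a b ∧ IsFrenetCurve σ a b ∧ IsFrenetFrame σ a b X κ ∧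
      jet m σ ξ.1 = ξ ∧ κ i ξ.1 = c

/-- The function `ϰ_i` on the jets of order `m` lying over Frenet jets,
`ϰ_i (j^m_t σ) = κ_i^σ (t)`. -/
def curvatureFun (m i : ℕ) (ξ : Jet m m) : ℝ :=
  Classical.epsilon (IsCurvatureAt i ξ)

/-- The pairs `(h, i)` of natural numbers with `h + i ≤ m - 1`. -/
abbrev InvariantIndex (m : ℕ) : Type :=
  {p : Fin m × Fin m // (p.1 : ℕ) + (p.2 : ℕ) ≤ m - 1}

end EuclideanJets

end

open Set
open scoped ContDiff

noncomputable section

namespace EuclideanJets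

variable {m r : ℕ}

/-! A vector field with skew derivative is affine, `x ↦ A x + b` with `A` skew, because its second
derivative is symmetric in two arguments and skew in two others. Its prolongation acts on jet
coordinates by `(0, A x_0 + b, A x_1, …, A x_r)`, so the fibre of the distribution is the range of
the linear map `killingMap` (`killingDistribution_eq_range`). The translations contribute `m`. The
rotations contribute as many dimensions as there are free coefficients `⟨A b_i, b_j⟩`, `i < j`, `i <
d`, where `d = min r (m - 1)` and `b` is a basis starting with the first `d` derivatives. Orders
beyond `m - 1` add nothing, since a skew map that kills `m - 1` independent vectors is zero. This
gives the rank.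

Differentials of invariants annihilate the distribution, so at a jet in general position there are
at most codimension-many independent ones; such jets are dense, and every open dense set contains
some. The bound is attained by `t` and the inner products `⟨x_i, x_j⟩`, `i ≤ j ≤ r`, `i ≤ m`, which
are defined on all of `J^r`.

The curvatures are written explicitly as `kap`, through Gram–Schmidt and a cross product for the
last frame vector. A Frenet curve has exactly these curvatures (`curvature_eq_kap`), and every curve
in general position has a Frenet frame (`exists_isFrenetFrame`), so `curvatureFun` agrees with `kap`
over Frenet jets. The function `ϰ_i` has order `i + 1`, and its derivative along `x_{i+1}` is a
nonzero multiple of `⟨X_{i+1}, ·⟩`. A total derivative raises the order by one and keeps this top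
coefficient, so `D_t^h ϰ_i` has order `h + i + 1 ≤ m`. Functions of equal order have distinct `i`,
hence orthogonal top coefficients, and `linearIndependent_of_top_order` makes the whole family
independent. Together with `t` its size is the codimension of the distribution, so the common kernel
of the differentials is the distribution itself. The inverse function theorem
(`exists_local_factorization`) then writes every invariant locally as a smooth function of the
family. -/

/-- The coordinates `x_k` of a jet, extended by zero to all `k`. -/
def coord {F : Type*} [Zero F] {r : ℕ} (ξ : ℝ × (Fin (r + 1) → F)) (k : ℕ) : F :=
  if h : k < r + 1 then ξ.2 ⟨k, h⟩ else 0

section Coord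

variable {F : Type*} [Zero F] {r : ℕ} (ξ : ℝ × (Fin (r + 1) → F))

theorem coord_val (k : Fin (r + 1)) : coord ξ k = ξ.2 k := by
  simp only [coord, k.isLt, dite_true]

theorem coord_of_le {k : ℕ} (hk : k ≤ r) : coord ξ k = ξ.2 ⟨k, Nat.lt_succ_of_le hk⟩ := by
  simp [coord, Nat.lt_succ_of_le hk]

theorem coord_of_lt {k : ℕ} (hk : r < k) : coord ξ k = 0 := by
  have : ¬ k < r + 1 := by omega
  simp [coord, this]

end Coord

/-! ### Skew maps, affine Killing fields and their flows -/

section Skew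

variable {F : Type*} [NormedAddCommGroup F] [InnerProductSpace ℝ F]

/-- Skew-symmetric endomorphisms of a Euclidean space. -/
def skewMaps (F : Type*) [NormedAddCommGroup F] [InnerProductSpace ℝ F] :
    Submodule ℝ (F →L[ℝ] F) where
  carrier := {A | ∀ u v, inner ℝ (A u) v + inner ℝ u (A v) = 0}
  add_mem' := by
    intro A B hA hB u v
    have h1 := hA u v
    have h2 := hB u v
    simp only [add_apply, inner_add_left, inner_add_right]
    linarith
  zero_mem' := by intro u v; simp
  smul_mem' := by
    intro c A hA u v
    have h1 := hA u v
    simp only [smul_apply, real_inner_smul_left, real_inner_smul_right]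
    rw [← mul_add, h1, mul_zero]

theorem inner_skew_apply {A : F →L[ℝ] F} (hA : A ∈ skewMaps F) (u v : F) :
    inner ℝ (A u) v = - inner ℝ u (A v) := eq_neg_of_add_eq_zero_left (hA u v)

theorem inner_skew_self {A : F →L[ℝ] F} (hA : A ∈ skewMaps F) (u : F) :
    inner ℝ (A u) u = 0 := by
  have := inner_skew_apply hA u u
  rw [real_inner_comm u] at this
  rw [real_inner_comm]
  linarith

/-- A vector field with everywhere skew-symmetric derivative is affine. -/
theorem exists_affine_of_skew_fderiv {X : F → F} (hs : ContDiff ℝ ∞ X)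
    (hk : ∀ x u v : F, inner ℝ (fderiv ℝ X x u) v + inner ℝ u (fderiv ℝ X x v) = 0) :
    ∃ A ∈ skewMaps F, ∃ b, ∀ x, X x = A x + b := by
  have hd : Differentiable ℝ X := hs.differentiable (by simp)
  have hd2 : Differentiable ℝ (fderiv ℝ X) :=
    (hs.fderiv_right (m := ∞) (by simp)).differentiable (by simp)
  have hskew : ∀ x w u v, inner ℝ (fderiv ℝ (fderiv ℝ X) x w u) v
      = - inner ℝ (fderiv ℝ (fderiv ℝ X) x w v) u := by
    intro x w u v
    have hA : ∀ u : F, HasFDerivAt (fun y => fderiv ℝ X y u)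
        ((ContinuousLinearMap.apply ℝ F u).comp (fderiv ℝ (fderiv ℝ X) x)) x := fun u =>
      (ContinuousLinearMap.apply ℝ F u).hasFDerivAt.comp x (hd2 x).hasFDerivAt
    have h1 := ((hA u).inner ℝ (hasFDerivAt_const v x)).add
      ((hasFDerivAt_const u x).inner ℝ (hA v))
    have h2 : HasFDerivAt (fun _ : F => (0 : ℝ)) (0 : F →L[ℝ] ℝ) x := hasFDerivAt_const _ _
    have h3 := h1.congr_of_eventuallyEq (f₁ := fun _ => (0 : ℝ))
      (Filter.Eventually.of_forall fun y => (hk y u v).symm)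
    have h4 := congrArg (fun L : F →L[ℝ] ℝ => L w) (h3.unique h2)
    simp [fderivInnerCLM_apply] at h4
    rw [real_inner_comm _ u] at h4
    linarith
  have hsymm : ∀ x w u, fderiv ℝ (fderiv ℝ X) x w u = fderiv ℝ (fderiv ℝ X) x u w := by
    intro x w u
    refine (hs.contDiffAt (x := x)).isSymmSndFDerivAt ?_ w u
    rw [minSmoothness_of_isRCLikeNormedField]
    exact WithTop.coe_le_coe.2 le_top
  -- The trilinear form `⟨D²X(w, u), v⟩` is symmetric in `w, u` and skew in `u, v`; permuting the
  -- arguments cyclically shows that it equals its own negative.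
  have hzero : ∀ x, fderiv ℝ (fderiv ℝ X) x = 0 := by
    intro x
    ext w u : 2
    refine ext_inner_right ℝ fun v => ?_
    rw [zero_apply, zero_apply, inner_zero_left]
    have e1 := hskew x w u v
    have e2 := hskew x v w u
    have e3 := hskew x u v w
    rw [hsymm x w v] at e1
    rw [hsymm x v u] at e2
    rw [hsymm x u w] at e3
    linarith
  have hconst : ∀ x, fderiv ℝ X x = fderiv ℝ X 0 := fun x =>
    is_const_of_fderiv_eq_zero hd2 hzero x 0
  refine ⟨fderiv ℝ X 0, fun u v => hk 0 u v, X 0, fun x => ?_⟩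
  have h5 : ∀ y, HasFDerivAt (fun y => X y - fderiv ℝ X 0 y) (0 : F →L[ℝ] F) y := by
    intro y
    have := (hd y).hasFDerivAt.sub ((fderiv ℝ X 0).hasFDerivAt (x := y))
    rwa [hconst y, sub_self] at this
  have h6 := is_const_of_fderiv_eq_zero (fun y => (h5 y).differentiableAt)
    (fun y => (h5 y).fderiv) x 0
  simp at h6
  rw [← h6]; abel

theorem fderiv_affine (A : F →L[ℝ] F) (b x : F) :
    fderiv ℝ (fun x => A x + b) x = A := by
  rw [fderiv_add_const, ContinuousLinearMap.fderiv]

theorem contDiff_affine (A : F →L[ℝ] F) (b : F) : ContDiff ℝ ∞ (fun x => A x + b) :=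
  A.contDiff.add contDiff_const

/-- The prolongation of the affine field `x ↦ A x + b` to `r`-jets, as a function of `(A, b)`. -/
def killingMap {r : ℕ} (ξ : ℝ × (Fin (r + 1) → F)) :
    (skewMaps F × F) →ₗ[ℝ] ℝ × (Fin (r + 1) → F) where
  toFun p := (0, fun k => p.1.1 (ξ.2 k) + if (k : ℕ) = 0 then p.2 else 0)
  map_add' p q := by
    refine Prod.ext (by simp) (funext fun k => ?_)
    simp only [Prod.fst_add, Submodule.coe_add, add_apply, Prod.snd_add, Pi.add_apply]
    split_ifs <;> abel
  map_smul' c p := by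
    refine Prod.ext (by simp) (funext fun k => ?_)
    simp only [Prod.smul_fst, Submodule.coe_smul, smul_apply, Prod.smul_snd, Pi.smul_apply,
      RingHom.id_apply, smul_add]
    split_ifs <;> simp

theorem killingMap_eq_add {r : ℕ} (ξ : ℝ × (Fin (r + 1) → F)) (p : skewMaps F × F) :
    killingMap ξ p = killingMap ξ (p.1, 0) + killingMap ξ (0, p.2) := by
  rw [← map_add, Prod.mk_add_mk, add_zero, zero_add]

open NormedSpace

theorem exp_zero_smul_apply (A : F →L[ℝ] F) (x : F) : exp ((0 : ℝ) • A) x = x := by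
  simp

theorem exp_smul_zero_apply (s : ℝ) (x : F) : exp (s • (0 : F →L[ℝ] F)) x = x := by
  simp

variable [CompleteSpace F]

theorem exp_neg_smul_apply_exp (A : F →L[ℝ] F) (s : ℝ) (x : F) :
    exp (s • (-A)) (exp (s • A) x) = x := by
  let _ : NormedAlgebra ℚ (F →L[ℝ] F) := NormedAlgebra.restrictScalars ℚ ℝ _
  have h : exp (s • (-A)) * exp (s • A) = 1 := by
    rw [← exp_add_of_commute]
    · simp
    · simp
  exact congrArg (fun L : F →L[ℝ] F => L x) h

theorem exp_apply_exp_neg_smul (A : F →L[ℝ] F) (s : ℝ) (x : F) :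
    exp (s • A) (exp (s • (-A)) x) = x := by
  simpa only [neg_neg] using exp_neg_smul_apply_exp (-A) s x

theorem hasDerivAt_exp_smul_apply (A : F →L[ℝ] F) (x : F) (s : ℝ) :
    HasDerivAt (fun u : ℝ => exp (u • A) x) (A (exp (s • A) x)) s := by
  have := (hasDerivAt_exp_smul_const' A s).clm_apply (hasDerivAt_const s x)
  simpa using this

/-- Every flow of an affine vector field consists of affine maps. -/
theorem affine_flow_eq {A : F →L[ℝ] F} {b : F} {φ : ℝ → F → F} (h0 : ∀ x, φ 0 x = x)
    (h : ∀ s x, HasDerivAt (fun s' => φ s' x) (A (φ s x) + b) s) (s : ℝ) (x : F) :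
    φ s x = exp (s • A) x + φ s 0 := by
  have h1 : ∀ s, HasDerivAt (fun u => φ u x - φ u 0) (A (φ s x - φ s 0)) s := by
    intro s
    refine ((h s x).sub (h s 0)).congr_deriv ?_
    rw [map_sub, add_sub_add_right_eq_sub]
  -- The difference of two trajectories solves the homogeneous linear equation, for which `exp (-u
  -- A)` is an integrating factor.
  have h2 : ∀ s, HasDerivAt (fun u : ℝ => exp (u • (-A)) (φ u x - φ u 0)) 0 s := by
    intro s
    refine ((hasDerivAt_exp_smul_const (-A) s).clm_apply (h1 s)).congr_deriv ?_
    simp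
  have h3 := is_const_of_deriv_eq_zero (fun u => (h2 u).differentiableAt) (fun u => (h2 u).deriv) s 0
  rw [h0, h0, exp_zero_smul_apply, sub_zero] at h3
  have h4 := congrArg (fun y => (exp (s • A) : F →L[ℝ] F) y) h3
  beta_reduce at h4
  rw [exp_apply_exp_neg_smul] at h4
  rw [← sub_eq_iff_eq_add, h4]

theorem inner_exp_smul_apply {A : F →L[ℝ] F} (hA : A ∈ skewMaps F) (s : ℝ) (x y : F) :
    inner ℝ (exp (s • A) x) (exp (s • A) y) = inner ℝ x y := by
  have h : ∀ s, HasDerivAt (fun u : ℝ => inner ℝ (exp (u • A) x) (exp (u • A) y)) (0 : ℝ) s := by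
    intro s
    refine ((hasDerivAt_exp_smul_apply A x s).inner ℝ
      (hasDerivAt_exp_smul_apply A y s)).congr_deriv ?_
    rw [add_comm]
    exact hA _ _
  have := is_const_of_deriv_eq_zero (fun u => (h u).differentiableAt) (fun u => (h u).deriv) s 0
  rwa [exp_zero_smul_apply, exp_zero_smul_apply] at this

/-- The half-time map `exp ((s / 2) A)` is an isometry, so its determinant squares to one, and `exp
(s A)` is the square of that map. This excludes `-1` without a continuity argument, and it is what
makes the oriented last curvature invariant. -/
theorem det_exp_smul [FiniteDimensional ℝ F] {A : F →L[ℝ] F} (hA : A ∈ skewMaps F) (s : ℝ) :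
    LinearMap.det (exp (s • A) : F →L[ℝ] F).toLinearMap = 1 := by
  have hadj : (exp ((s / 2) • A)).toLinearMap.adjoint * (exp ((s / 2) • A)).toLinearMap = 1 := by
    refine LinearMap.ext fun x => ext_inner_right ℝ fun y => ?_
    rw [Module.End.mul_apply, LinearMap.adjoint_inner_left]
    exact inner_exp_smul_apply hA (s / 2) x y
  have hdet := congrArg LinearMap.det hadj
  let e := stdOrthonormalBasis ℝ F
  have hT : LinearMap.det (exp ((s / 2) • A)).toLinearMap.adjoint
      = LinearMap.det (exp ((s / 2) • A)).toLinearMap := by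
    rw [← LinearMap.det_toMatrix e.toBasis, ← LinearMap.det_toMatrix e.toBasis,
      LinearMap.toMatrix_adjoint, Matrix.det_conjTranspose]
    simp
  rw [map_mul, map_one, hT] at hdet
  let _ : NormedAlgebra ℚ (F →L[ℝ] F) := NormedAlgebra.restrictScalars ℚ ℝ _
  have h2 : exp (s • A) = exp ((s / 2) • A) * exp ((s / 2) • A) := by
    rw [← exp_add_of_commute (Commute.refl _), ← add_smul, add_halves]
  rw [h2]
  refine Eq.trans ?_ hdet
  exact (map_mul LinearMap.det _ _)

/-- The action on jets of the affine map `x ↦ L x + c`. -/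
def affineAct {r : ℕ} (L : F →L[ℝ] F) (c : F) (ξ : ℝ × (Fin (r + 1) → F)) :
    ℝ × (Fin (r + 1) → F) :=
  (ξ.1, fun k => L (ξ.2 k) + if (k : ℕ) = 0 then c else 0)

theorem hasDerivAt_affineAct_exp {r : ℕ} (A : skewMaps F) {c : ℝ → F} {b : F}
    (hc : HasDerivAt c b 0) (ξ : ℝ × (Fin (r + 1) → F)) :
    HasDerivAt (fun s : ℝ => affineAct (exp (s • A.1)) (c s) ξ) (killingMap ξ (A, b)) 0 := by
  refine (hasDerivAt_const _ _).prodMk (hasDerivAt_pi.2 fun k => ?_)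
  refine HasDerivAt.add ?_ ?_
  · have := hasDerivAt_exp_smul_apply A.1 (ξ.2 k) 0
    rwa [exp_zero_smul_apply] at this
  · by_cases hk : (k : ℕ) = 0
    · simp only [hk, if_true]; exact hc
    · simp only [hk, if_false]; exact hasDerivAt_const (0 : ℝ) (0 : F)

theorem hasDerivAt_affineAct_translation {r : ℕ} (b : F) (ξ : ℝ × (Fin (r + 1) → F)) :
    HasDerivAt (fun s : ℝ => affineAct (ContinuousLinearMap.id ℝ F) (s • b) ξ)
      (killingMap ξ (0, b)) 0 := by
  have hc : HasDerivAt (fun s : ℝ => s • b) b 0 := by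
    simpa using (hasDerivAt_id (0 : ℝ)).smul_const b
  have h := hasDerivAt_affineAct_exp 0 hc ξ
  have : ∀ s : ℝ, exp (s • ((0 : skewMaps F) : F →L[ℝ] F)) = ContinuousLinearMap.id ℝ F :=
    fun s => ContinuousLinearMap.ext fun x => exp_smul_zero_apply s x
  simpa only [this] using h

end Skew

/-! ### Taylor curves and the prolongation of affine maps -/

theorem coord_proj {l : ℕ} (h : l ≤ r) (ξ : Jet m r) {k : ℕ} (hk : k ≤ l) :
    coord (proj h ξ) k = coord ξ k := by
  rw [coord_of_le _ hk, coord_of_le _ (hk.trans h)]; rfl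

theorem coord_jet (σ : ℝ → E m) (t : ℝ) {k : ℕ} (hk : k ≤ r) :
    coord (jet r σ t) k = iteratedDeriv k σ t := by
  rw [coord_of_le _ hk]; rfl

theorem taylorCurve_eq_sum_range (ξ : Jet m r) (s : ℝ) :
    taylorCurve ξ s = ∑ k ∈ Finset.range (r + 1),
      ((s - ξ.1) ^ k / (Nat.factorial k : ℝ)) • coord ξ k := by
  rw [Finset.sum_range]
  simp [taylorCurve, coord_val]

theorem contDiff_taylorCurve (ξ : Jet m r) : ContDiff ℝ ∞ (taylorCurve ξ) := by
  unfold taylorCurve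
  fun_prop

theorem hasDerivAt_pow_div_factorial_smul {F : Type*} [NormedAddCommGroup F] [NormedSpace ℝ F]
    (N : ℕ) (c : ℕ → F) (t s : ℝ) :
    HasDerivAt (fun s => ∑ k ∈ Finset.range (N + 1),
      ((s - t) ^ k / (Nat.factorial k : ℝ)) • c k)
      (∑ k ∈ Finset.range N, ((s - t) ^ k / (Nat.factorial k : ℝ)) • c (k + 1)) s := by
  have h : ∀ k ∈ Finset.range (N + 1), HasDerivAt
      (fun s => ((s - t) ^ k / (Nat.factorial k : ℝ)) • c k)
      ((((k : ℝ) * (s - t) ^ (k - 1) * 1) / (Nat.factorial k : ℝ)) • c k) s := by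
    intro k _
    exact ((((hasDerivAt_id s).sub_const t).pow k).div_const _).smul_const _
  refine (HasDerivAt.fun_sum h).congr_deriv ?_
  rw [Finset.sum_range_succ']
  simp only [Nat.cast_zero, zero_mul, zero_div, zero_smul, add_zero]
  refine Finset.sum_congr rfl fun k _ => ?_
  congr 1
  have : (Nat.factorial k : ℝ) ≠ 0 := by positivity
  have : ((k : ℝ) + 1) ≠ 0 := by positivity
  rw [Nat.factorial_succ]
  push_cast
  field_simp

/-- Each differentiation shifts the coefficients by one. Extending `coord` by zero lets the range of
summation stay fixed, because the term lost at the top is zero. -/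
theorem iteratedDeriv_taylorCurve (ξ : Jet m r) (n : ℕ) :
    iteratedDeriv n (taylorCurve ξ) = fun s => ∑ k ∈ Finset.range (r + 1),
      ((s - ξ.1) ^ k / (Nat.factorial k : ℝ)) • coord ξ (k + n) := by
  induction n with
  | zero => funext s; simp [taylorCurve_eq_sum_range]
  | succ n ih =>
    rw [iteratedDeriv_succ, ih]
    funext s
    rw [(hasDerivAt_pow_div_factorial_smul r (fun k => coord ξ (k + n)) ξ.1 s).deriv,
      Finset.sum_range_succ, coord_of_lt ξ (show r < r + (n + 1) by omega), smul_zero, add_zero]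
    refine Finset.sum_congr rfl fun k _ => ?_
    congr 2
    omega

theorem iteratedDeriv_taylorCurve_self (ξ : Jet m r) (n : ℕ) :
    iteratedDeriv n (taylorCurve ξ) ξ.1 = coord ξ n := by
  rw [iteratedDeriv_taylorCurve]
  beta_reduce
  rw [Finset.sum_eq_single 0]
  · rw [pow_zero, Nat.factorial_zero, Nat.cast_one, div_one, one_smul, zero_add]
  · intro k _ hk
    rw [sub_self, zero_pow hk, zero_div, zero_smul]
  · intro h; exact absurd (Finset.mem_range.2 (Nat.succ_pos r)) h

theorem jet_taylorCurve (ξ : Jet m r) : jet r (taylorCurve ξ) ξ.1 = ξ := by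
  refine Prod.ext rfl (funext fun k => ?_)
  exact (iteratedDeriv_taylorCurve_self ξ k).trans (coord_val ξ k)

theorem iteratedDeriv_clm_add_const {f : ℝ → E m} (hf : ContDiff ℝ ∞ f) (L : E m →L[ℝ] E m)
    (c : E m) (n : ℕ) :
    iteratedDeriv n (fun s => L (f s) + c) =
      fun s => L (iteratedDeriv n f s) + if n = 0 then c else 0 := by
  induction n with
  | zero => simp
  | succ n ih =>
    rw [iteratedDeriv_succ, ih]
    funext s
    have h1 : DifferentiableAt ℝ (iteratedDeriv n f) s :=
      (hf.differentiable_iteratedDeriv n (by exact_mod_cast WithTop.coe_lt_top _)).differentiableAt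
    have h2 := (L.hasFDerivAt.comp_hasDerivAt s h1.hasDerivAt).add_const
      (if n = 0 then c else 0)
    simpa [iteratedDeriv_succ] using h2.deriv

theorem prolong_affine (L : E m →L[ℝ] E m) (c : E m) (ξ : Jet m r) :
    prolong r (fun x => L x + c) ξ = affineAct L c ξ := by
  refine Prod.ext rfl (funext fun k => ?_)
  have := congrFun (iteratedDeriv_clm_add_const (contDiff_taylorCurve ξ) L c k) ξ.1
  rw [iteratedDeriv_taylorCurve_self, coord_val] at this
  exact this

open NormedSpace in
/-- The fibre of the Killing distribution consists of the prolonged affine fields with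
skew-symmetric linear part. -/
theorem killingDistribution_eq_range (ξ : Jet m r) :
    killingDistribution ξ = LinearMap.range (killingMap ξ) := by
  apply le_antisymm
  · refine Submodule.span_le.2 ?_
    rintro V ⟨X, hX, φ, hφ, hV⟩
    obtain ⟨A, hA, b, hXA⟩ := exists_affine_of_skew_fderiv hX.1 hX.2
    obtain rfl : X = fun x => A x + b := funext hXA
    have h1 : ∀ s, prolong r (φ s) ξ = affineAct (exp (s • A)) (φ s 0) ξ := by
      intro s
      rw [← prolong_affine]
      congr 1
      exact funext (affine_flow_eq hφ.1 hφ.2 s)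
    simp only [h1] at hV
    have hc : HasDerivAt (fun s => φ s 0) b 0 := by
      have := hφ.2 0 0
      beta_reduce at this
      rwa [hφ.1, map_zero, zero_add] at this
    exact ⟨(⟨A, hA⟩, b), ((hasDerivAt_affineAct_exp ⟨A, hA⟩ hc ξ).unique hV)⟩
  · rintro _ ⟨⟨A, b⟩, rfl⟩
    rw [killingMap_eq_add]
    -- Membership in the span is enough, so a general affine field can be split into a linear and a
    -- constant one, whose flows `exp (s A)` and `x + s b` are explicit.
    refine Submodule.add_mem _ (Submodule.subset_span ?_) (Submodule.subset_span ?_)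
    · refine ⟨fun x => A.1 x + 0, ⟨contDiff_affine _ _, fun x u v => ?_⟩,
        fun s x => exp (s • A.1) x + 0, ⟨fun x => ?_, fun s x => ?_⟩, ?_⟩
      · rw [fderiv_affine]; exact A.2 u v
      · beta_reduce; rw [exp_zero_smul_apply, add_zero]
      · simp only [add_zero]; exact hasDerivAt_exp_smul_apply A.1 x s
      · simp only [prolong_affine]
        exact hasDerivAt_affineAct_exp A (hasDerivAt_const (0 : ℝ) (0 : E m)) ξ
    · refine ⟨fun x => (0 : E m →L[ℝ] E m) x + b, ⟨contDiff_affine _ _, fun x u v => ?_⟩,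
        fun s x => ContinuousLinearMap.id ℝ (E m) x + s • b, ⟨fun x => ?_, fun s x => ?_⟩, ?_⟩
      · rw [fderiv_affine]; simp
      · simp
      · simpa using ((hasDerivAt_id s).smul_const b).const_add x
      · simp only [prolong_affine]
        exact hasDerivAt_affineAct_translation b ξ

theorem affineAct_id_zero (ξ : Jet m r) : affineAct (ContinuousLinearMap.id ℝ (E m)) 0 ξ = ξ := by
  refine Prod.ext rfl (funext fun k => ?_)
  simp [affineAct]

/-- A differentiable function that is invariant under the prolongations of translations and
rotations is annihilated by the Killing distribution. -/
theorem fderiv_apply_of_mem_killingDistribution {f : Jet m r → ℝ} {ξ : Jet m r}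
    (hf : DifferentiableAt ℝ f ξ)
    (htrans : ∀ b, f (affineAct (ContinuousLinearMap.id ℝ (E m)) b ξ) = f ξ)
    (hrot : ∀ A ∈ skewMaps (E m), ∀ s : ℝ, f (affineAct (NormedSpace.exp (s • A)) 0 ξ) = f ξ)
    {V : Jet m r} (hV : V ∈ killingDistribution ξ) : fderiv ℝ f ξ V = 0 := by
  rw [killingDistribution_eq_range] at hV
  obtain ⟨⟨A, b⟩, rfl⟩ := hV
  rw [killingMap_eq_add, map_add]
  have key : ∀ (γ : ℝ → Jet m r) (V : Jet m r), HasDerivAt γ V 0 → γ 0 = ξ →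
      (∀ s, f (γ s) = f ξ) → fderiv ℝ f ξ V = 0 := by
    intro γ V hγ h0 hc
    have h1 : HasFDerivAt f (fderiv ℝ f ξ) (γ 0) := h0 ▸ hf.hasFDerivAt
    have h2 := h1.comp_hasDerivAt (0 : ℝ) hγ
    have h3 : f ∘ γ = fun _ => f ξ := funext hc
    rw [h3] at h2
    exact h2.unique (hasDerivAt_const _ _)
  have e1 : affineAct (NormedSpace.exp ((0 : ℝ) • A.1)) 0 ξ = ξ := by
    refine Prod.ext rfl (funext fun k => ?_)
    simp only [affineAct, exp_zero_smul_apply, ite_self, add_zero]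
  rw [key _ _ (hasDerivAt_affineAct_exp A (hasDerivAt_const (0 : ℝ) (0 : E m)) ξ) e1
      (hrot A.1 A.2),
    key _ _ (hasDerivAt_affineAct_translation b ξ) (by
      rw [zero_smul, affineAct_id_zero]) (fun s => htrans _), add_zero]

/-! ### Linear algebra: ranks, independence and codimension -/

section LinearAlgebra

variable {F : Type*} [NormedAddCommGroup F] [InnerProductSpace ℝ F]

/-- Both ranges are quotients by the common kernel. This allows `killingMap` to be exchanged for a
surjective map. -/
theorem finrank_range_eq_of_ker_eq {V V₁ V₂ : Type*} [AddCommGroup V] [Module ℝ V]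
    [AddCommGroup V₁] [Module ℝ V₁] [AddCommGroup V₂] [Module ℝ V₂] (f : V →ₗ[ℝ] V₁)
    (g : V →ₗ[ℝ] V₂) (h : LinearMap.ker f = LinearMap.ker g) :
    Module.finrank ℝ (LinearMap.range f) = Module.finrank ℝ (LinearMap.range g) :=
  ((f.quotKerEquivRange.symm.trans (Submodule.quotEquivOfEq _ _ h)).trans
    g.quotKerEquivRange).finrank_eq

/-- Index pairs `i < j` with `i < d`. -/
abbrev SkewIndex (m d : ℕ) : Type := {p : Fin m × Fin m // p.1 < p.2 ∧ (p.1 : ℕ) < d}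

/-- Row `i` of the strict upper triangle has `m - 1 - i` entries. The sum is stated doubled and free
of subtraction so that it can be cast to `ℝ`. -/
theorem two_mul_card_skewIndex {m d : ℕ} (hd : d ≤ m) :
    2 * Fintype.card (SkewIndex m d) + d * (d + 1) = 2 * m * d := by
  have h1 : Fintype.card (SkewIndex m d) = ∑ i ∈ Finset.range m, if i < d then m - 1 - i else 0 := by
    have e : SkewIndex m d ≃ Σ i : Fin m, {j : Fin m // i < j ∧ (i : ℕ) < d} :=
      { toFun := fun p => ⟨p.1.1, p.1.2, p.2⟩
        invFun := fun q => ⟨(q.1, q.2.1), q.2.2⟩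
        left_inv := fun _ => rfl
        right_inv := fun _ => rfl }
    rw [Fintype.card_congr e, Fintype.card_sigma, Finset.sum_range]
    refine Finset.sum_congr rfl fun i _ => ?_
    rw [Fintype.card_subtype]
    split_ifs with h
    · simp only [h, and_true]
      rw [← Fin.card_Ioi]
      congr 1
      ext j; simp
    · simp [h]
  have h2 : ∀ d, d ≤ m → (∑ i ∈ Finset.range m, if i < d then m - 1 - i else 0)
      = ∑ i ∈ Finset.range d, (m - 1 - i) := by
    intro d hd
    rw [← Finset.sum_filter]
    congr 1
    ext i; simp; omega
  rw [h1, h2 d hd]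
  clear h1
  induction d with
  | zero => simp
  | succ d ih =>
    have := ih (by omega)
    rw [Finset.sum_range_succ, mul_add, mul_add]
    obtain ⟨c, rfl⟩ : ∃ c, m = d + 1 + c := ⟨m - (d + 1), by omega⟩
    have : d + 1 + c - 1 - d = c := by omega
    rw [this]
    nlinarith

/-- Functionals on jets whose top order parts are independent are independent, also together with
the independent variable. -/
theorem linearIndependent_of_top_order {r : ℕ} {ι : Type*} [Fintype ι]
    (φ : ι → (ℝ × (Fin (r + 1) → F)) →L[ℝ] ℝ) (o : ι → Fin (r + 1)) (w : ι → F)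
    (h1 : ∀ p k v, o p < k → φ p (0, Pi.single k v) = 0)
    (h2 : ∀ p v, φ p (0, Pi.single (o p) v) = inner ℝ (w p) v)
    (h3 : ∀ k, LinearIndependent ℝ (fun p : {p // o p = k} => w p)) :
    LinearIndependent ℝ (fun a : Option ι =>
      a.elim (ContinuousLinearMap.fst ℝ ℝ (Fin (r + 1) → F)) φ) := by
  classical
  rw [Fintype.linearIndependent_iff]
  intro g hg
  have hv : ∀ v, g none * v.1 + ∑ p, g (some p) * φ p v = 0 := by
    intro v
    have := congrArg (fun L : (ℝ × (Fin (r + 1) → F)) →L[ℝ] ℝ => L v) hg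
    simpa [Fintype.sum_option] using this
  -- Descent from the highest order. On vectors in slot `o p` the functionals of lower order vanish
  -- and those of higher order already have coefficient zero, so a relation among the `w q` of the
  -- same order remains.
  have key : ∀ n : ℕ, ∀ p, r - (o p : ℕ) = n → g (some p) = 0 := by
    intro n
    induction n using Nat.strong_induction_on with
    | _ n ih =>
      intro p hp
      have hsum : ∑ q : {q // o q = o p}, g (some q.1) • w q = 0 := by
        refine ext_inner_right ℝ fun v => ?_
        have e1 := hv (0, Pi.single (o p) v)
        rw [mul_zero, zero_add] at e1
        rw [inner_zero_left, ← e1, sum_inner,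
          ← Finset.sum_subtype (Finset.univ.filter fun q => o q = o p) (fun q => by simp)
            (fun q => inner ℝ (g (some q) • w q) v), Finset.sum_filter]
        refine Finset.sum_congr rfl fun q _ => ?_
        split_ifs with hq
        · rw [← hq, h2, real_inner_smul_left]
        · rcases lt_or_gt_of_ne hq with hlt | hgt
          · rw [h1 _ _ _ hlt, mul_zero]
          · rw [ih _ (by have := (o q).isLt; have : (o p : ℕ) < o q := hgt; omega) q rfl, zero_mul]
      exact Fintype.linearIndependent_iff.1 (h3 (o p)) _ hsum ⟨p, rfl⟩
  have hsome : ∀ p, g (some p) = 0 := fun p => key _ p rfl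
  have hnone : g none = 0 := by
    have := hv (1, 0)
    simpa [hsome] using this
  rintro (_ | p)
  · exact hnone
  · exact hsome p

variable [FiniteDimensional ℝ F]

/-- The position matters: the given vectors must come first, so that the index condition `i < d`
singles them out. -/
theorem exists_basis_extending {m d : ℕ} (hm : Module.finrank ℝ F = m) (hd : d ≤ m)
    {v : Fin d → F} (hv : LinearIndependent ℝ v) :
    ∃ b : Module.Basis (Fin m) ℝ F, ∀ i : Fin d, b (Fin.castLE hd i) = v i := by
  let B := Module.Basis.sumExtend hv
  have : Fintype (Fin d ⊕ Module.Basis.sumExtendIndex hv) :=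
    FiniteDimensional.fintypeBasisIndex B
  have : Fintype (Module.Basis.sumExtendIndex hv) :=
    Fintype.ofInjective (Sum.inr (α := Fin d)) Sum.inr_injective
  have hc : Fintype.card (Module.Basis.sumExtendIndex hv) = m - d := by
    have := Module.finrank_eq_nat_card_basis B
    rw [hm, Nat.card_sum, Nat.card_eq_fintype_card, Nat.card_eq_fintype_card, Fintype.card_fin] at this
    omega
  let e : Fin d ⊕ Module.Basis.sumExtendIndex hv ≃ Fin m :=
    ((Equiv.sumCongr (Equiv.refl _) (Fintype.equivFinOfCardEq hc)).trans finSumFinEquiv).trans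
      (finCongr (by omega))
  refine ⟨B.reindex e, fun i => ?_⟩
  have h1 : e.symm (Fin.castLE hd i) = Sum.inl i := by
    rw [Equiv.symm_apply_eq]
    apply Fin.ext
    simp [e]
  rw [Module.Basis.reindex_apply, h1]
  simp only [B, Module.Basis.sumExtend, Module.Basis.reindex_apply, Module.Basis.extend_apply_self]
  let _ := Classical.decPred (· ∈ range v)
  exact congrArg Subtype.val (Equiv.Set.sumDiffSubset_apply_inl
    (hv.linearIndepOn_id.subset_extend _) (Equiv.ofInjective v hv.injective i))

/-- A skew-symmetric map with prescribed upper triangular coefficients in a basis. -/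
theorem exists_skew_of_coeff {m d : ℕ} (b : Module.Basis (Fin m) ℝ F) (c : SkewIndex m d → ℝ) :
    ∃ A ∈ skewMaps F, ∀ p : SkewIndex m d, inner ℝ (A (b p.1.1)) (b p.1.2) = c p := by
  let ℓ : Fin m → (F →L[ℝ] ℝ) := fun i => LinearMap.toContinuousLinearMap (b.coord i)
  have hℓ : ∀ i j, ℓ i (b j) = if i = j then 1 else 0 := by
    intro i j
    simp [ℓ, Finsupp.single_apply, eq_comm]
  let ds : Fin m → F := fun i => (InnerProductSpace.toDual ℝ F).symm (ℓ i)
  have hds : ∀ i u, inner ℝ (ds i) u = ℓ i u := fun i u =>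
    InnerProductSpace.toDual_symm_apply
  -- With the dual basis `ds`, each summand is an elementary skew map whose coefficients in `b` are
  -- supported on the positions `(i, j)` and `(j, i)`.
  let A : F →L[ℝ] F := ∑ p : SkewIndex m d,
    c p • ((ℓ p.1.1).smulRight (ds p.1.2) - (ℓ p.1.2).smulRight (ds p.1.1))
  have hA : ∀ u v, inner ℝ (A u) v
      = ∑ p : SkewIndex m d, c p * (ℓ p.1.1 u * ℓ p.1.2 v - ℓ p.1.2 u * ℓ p.1.1 v) := by
    intro u v
    simp only [A, sum_apply, sum_inner, smul_apply, sub_apply,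
      ContinuousLinearMap.smulRight_apply, inner_sub_left, real_inner_smul_left, hds]
  refine ⟨A, fun u v => ?_, fun q => ?_⟩
  · rw [real_inner_comm _ u, hA, hA, ← Finset.sum_add_distrib]
    refine Finset.sum_eq_zero fun p _ => ?_
    ring
  · rw [hA, Finset.sum_eq_single q]
    · have h1 : q.1.2 ≠ q.1.1 := ne_of_gt q.2.1
      simp [hℓ, h1]
    · intro p _ hp
      simp only [hℓ]
      have h2 : ¬ (p.1.1 = q.1.1 ∧ p.1.2 = q.1.2) := fun h =>
        hp (Subtype.ext (Prod.ext h.1 h.2))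
      have h3 : ¬ (p.1.2 = q.1.1 ∧ p.1.1 = q.1.2) := fun h => by
        have e1 := p.2.1
        have e2 := q.2.1
        rw [h.1, h.2] at e1
        exact lt_asymm e1 e2
      rcases not_and_or.1 h2 with h2 | h2 <;> rcases not_and_or.1 h3 with h3 | h3 <;>
        simp [h2, h3]
    · simp

/-- The rank of the prolonged affine fields when the rotations that fix all derivatives are those
that fix the first `d` vectors of a basis. -/
theorem finrank_range_killingMap {m d r : ℕ} (ξ : ℝ × (Fin (r + 1) → F))
    (b : Module.Basis (Fin m) ℝ F)
    (h : ∀ A ∈ skewMaps F, (∀ k : Fin (r + 1), (k : ℕ) ≠ 0 → A (ξ.2 k) = 0) ↔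
      ∀ i : Fin m, (i : ℕ) < d → A (b i) = 0) :
    Module.finrank ℝ (LinearMap.range (killingMap ξ))
      = m + Fintype.card (SkewIndex m d) := by
  -- This map has the same kernel as `killingMap ξ` but is onto: the rotation coefficients can be
  -- prescribed freely, and the translation then corrects the zeroth component.
  let g : (skewMaps F × F) →ₗ[ℝ] (SkewIndex m d → ℝ) × F :=
    { toFun := fun p => (fun q => inner ℝ (p.1.1 (b q.1.1)) (b q.1.2), p.1.1 (ξ.2 0) + p.2)
      map_add' := by
        intro p q
        refine Prod.ext (funext fun i => ?_) ?_
        · simp [inner_add_left]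
        · simp; abel
      map_smul' := by
        intro c p
        refine Prod.ext (funext fun i => ?_) ?_
        · simp [real_inner_smul_left]
        · simp }
  have hker : LinearMap.ker (killingMap ξ) = LinearMap.ker g := by
    ext ⟨A, w⟩
    have h0 : (A, w) ∈ LinearMap.ker (killingMap ξ) ↔
        (A.1 (ξ.2 0) + w = 0 ∧ ∀ k : Fin (r + 1), (k : ℕ) ≠ 0 → A.1 (ξ.2 k) = 0) := by
      rw [LinearMap.mem_ker]
      constructor
      · intro hz
        have hz2 := fun k => congrFun (congrArg Prod.snd hz) k
        refine ⟨by simpa [killingMap] using hz2 0, fun k hk => ?_⟩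
        have := hz2 k
        simp only [killingMap, LinearMap.coe_mk, AddHom.coe_mk, hk, if_false, add_zero] at this
        exact this
      · rintro ⟨h1, h2⟩
        refine Prod.ext rfl (funext fun k => ?_)
        by_cases hk : (k : ℕ) = 0
        · obtain rfl : k = 0 := Fin.ext hk
          simpa [killingMap] using h1
        · simp only [killingMap, LinearMap.coe_mk, AddHom.coe_mk, hk, if_false, add_zero]
          exact h2 k hk
    rw [h0, h A.1 A.2, LinearMap.mem_ker]
    constructor
    · rintro ⟨h1, h2⟩
      refine Prod.ext (funext fun q => ?_) h1
      change inner ℝ (A.1 (b q.1.1)) (b q.1.2) = 0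
      rw [h2 _ q.2.2, inner_zero_left]
    · intro hg
      refine ⟨congrArg Prod.snd hg, fun i hi => ?_⟩
      have h3 : ∀ q : SkewIndex m d, inner ℝ (A.1 (b q.1.1)) (b q.1.2) = 0 := fun q =>
        congrFun (congrArg Prod.fst hg) q
      refine InnerProductSpace.ext_inner_right_basis b fun j => ?_
      rw [inner_zero_left]
      rcases lt_trichotomy i j with hij | rfl | hij
      · exact h3 ⟨(i, j), hij, hi⟩
      · exact inner_skew_self A.2 _
      · rw [inner_skew_apply A.2, real_inner_comm]
        have : (j : ℕ) < d := lt_trans hij hi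
        simpa using h3 ⟨(j, i), hij, this⟩
  have hsurj : LinearMap.range g = ⊤ := by
    rw [LinearMap.range_eq_top]
    rintro ⟨c, w⟩
    obtain ⟨A, hA, hc⟩ := exists_skew_of_coeff b c
    exact ⟨(⟨A, hA⟩, w - A (ξ.2 0)), Prod.ext (funext hc) (add_sub_cancel _ _)⟩
  rw [finrank_range_eq_of_ker_eq _ g hker, hsurj, finrank_top, Module.finrank_prod,
    Module.finrank_eq_card_basis b]
  simp [add_comm]

/-- If the range were proper, a nonzero functional vanishing on it would be a linear relation among
the `φ i`. -/
theorem surjective_of_linearIndependent_functionals {V ι : Type*} [AddCommGroup V] [Module ℝ V]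
    [Fintype ι] [DecidableEq ι] {φ : ι → (V →ₗ[ℝ] ℝ)} (h : LinearIndependent ℝ φ) :
    Function.Surjective (LinearMap.pi φ) := by
  rw [← LinearMap.range_eq_top]
  by_contra hne
  obtain ⟨c, hc0, hc⟩ := Submodule.exists_le_ker_of_lt_top _ (lt_top_iff_ne_top.2 hne)
  apply hc0
  rw [Fintype.linearIndependent_iff] at h
  have h1 := h (fun i => c (Pi.single i 1)) (by
    ext v
    have h2 : c (LinearMap.pi φ v) = 0 := hc ⟨v, rfl⟩
    rw [← LinearMap.sum_single_apply (fun _ : ι => ℝ) (LinearMap.pi φ v), map_sum] at h2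
    rw [LinearMap.sum_apply, LinearMap.zero_apply, ← h2]
    refine Finset.sum_congr rfl fun i _ => ?_
    rw [LinearMap.smul_apply, smul_eq_mul, mul_comm, ← smul_eq_mul, ← map_smul, ← Pi.single_smul]
    simp)
  refine LinearMap.pi_ext' fun i => LinearMap.ext_ring ?_
  simpa using h1 i

/-- Independent functionals that vanish on a subspace are at most as many as its codimension. -/
theorem card_add_finrank_le {V ι : Type*} [NormedAddCommGroup V] [NormedSpace ℝ V]
    [FiniteDimensional ℝ V] [Fintype ι] {φ : ι → (V →L[ℝ] ℝ)} (h : LinearIndependent ℝ φ)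
    (D : Submodule ℝ V) (hD : ∀ i, ∀ v ∈ D, φ i v = 0) :
    Fintype.card ι + Module.finrank ℝ D ≤ Module.finrank ℝ V := by
  classical
  have h' : LinearIndependent ℝ (fun i => (φ i : V →ₗ[ℝ] ℝ)) :=
    h.map' (ContinuousLinearMap.coeLM ℝ) (LinearMap.ker_eq_bot.2 ContinuousLinearMap.coe_injective)
  have hs := surjective_of_linearIndependent_functionals h'
  have h1 := LinearMap.finrank_range_add_finrank_ker (LinearMap.pi fun i => (φ i : V →ₗ[ℝ] ℝ))
  rw [LinearMap.range_eq_top.2 hs, finrank_top, Module.finrank_fintype_fun_eq_card] at h1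
  have h2 : D ≤ LinearMap.ker (LinearMap.pi fun i => (φ i : V →ₗ[ℝ] ℝ)) := fun v hv =>
    LinearMap.mem_ker.2 (funext fun i => hD i v hv)
  have h3 := Submodule.finrank_mono h2
  omega

end LinearAlgebra

/-! ### Jets in general position: openness, density and the rank -/

section Jets

variable {F : Type*} [NormedAddCommGroup F] [InnerProductSpace ℝ F]

theorem coord_affineAct_succ (L : F →L[ℝ] F) (c : F) (ξ : ℝ × (Fin (r + 1) → F)) (k : ℕ) :
    coord (affineAct L c ξ) (k + 1) = L (coord ξ (k + 1)) := by
  unfold coord affineAct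
  split_ifs <;> simp

/-- The coordinate `x_k` as a continuous linear map. -/
def coordL (F : Type*) [NormedAddCommGroup F] [InnerProductSpace ℝ F] (r k : ℕ) :
    (ℝ × (Fin (r + 1) → F)) →L[ℝ] F :=
  if h : k < r + 1 then
    (ContinuousLinearMap.proj (φ := fun _ : Fin (r + 1) => F) ⟨k, h⟩).comp
      (ContinuousLinearMap.snd ℝ ℝ (Fin (r + 1) → F))
  else 0

theorem coordL_apply (k : ℕ) (ξ : ℝ × (Fin (r + 1) → F)) : coordL F r k ξ = coord ξ k := by
  unfold coordL coord
  split_ifs <;> simp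

theorem coord_single {F : Type*} [NormedAddCommGroup F] (l : Fin (r + 1)) (v : F) (k : ℕ) :
    coord ((0, Pi.single l v) : ℝ × (Fin (r + 1) → F)) k = if k = l then v else 0 := by
  rcases le_or_gt k r with hk | hk
  · rw [coord_of_le _ hk]
    by_cases h : k = l
    · subst h; simp
    · have : (⟨k, Nat.lt_succ_of_le hk⟩ : Fin (r + 1)) ≠ l := fun e => h (by rw [← e])
      simp [h, this]
  · have : k ≠ l := by have := l.isLt; omega
    rw [coord_of_lt _ hk, if_neg this]

theorem contDiff_coord (k : ℕ) : ContDiff ℝ ∞ (fun ξ : ℝ × (Fin (r + 1) → F) => coord ξ k) := by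
  simp only [← coordL_apply]
  exact (coordL F r k).contDiff

/-- The first `d` derivatives of a jet are linearly independent. -/
def DerivIndependent (d : ℕ) (ξ : ℝ × (Fin (r + 1) → F)) : Prop :=
  LinearIndependent ℝ (fun i : Fin d => coord ξ (i + 1))

theorem DerivIndependent.mono {d d' : ℕ} {ξ : ℝ × (Fin (r + 1) → F)} (h : DerivIndependent d ξ)
    (hd : d' ≤ d) : DerivIndependent d' ξ :=
  LinearIndependent.comp h (Fin.castLE hd) (Fin.castLE_injective hd)

theorem isOpen_derivIndependent (d : ℕ) :
    IsOpen {ξ : ℝ × (Fin (r + 1) → F) | DerivIndependent d ξ} :=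
  isOpen_setOfPred_linearIndependent.preimage (f := fun (ξ : ℝ × (Fin (r + 1) → F)) (i : Fin d) =>
    coord ξ (i + 1)) (continuous_pi fun _ => (contDiff_coord _).continuous)

/-- A left inverse `π` of `e` sends the family to the rows of `s - M`, where `M` has rows `-π (v
i)`. Independence can fail only at roots of the characteristic polynomial of `M`. -/
theorem finite_not_linearIndependent_add_smul {d : ℕ} (v : Fin d → F) {e : Fin d → F}
    (he : LinearIndependent ℝ e) :
    {s : ℝ | ¬ LinearIndependent ℝ (fun i => v i + s • e i)}.Finite := by
  obtain ⟨π, hπ⟩ : ∃ π : F →ₗ[ℝ] (Fin d → ℝ), ∀ i, π (e i) = Pi.single i 1 := by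
    obtain ⟨π, hπ⟩ := LinearMap.exists_leftInverse_of_injective
      (Fintype.linearCombination ℝ e) (LinearMap.ker_eq_bot.2
        (linearIndependent_iff_injective_fintypeLinearCombination.1 he))
    refine ⟨π, fun i => ?_⟩
    have := congrArg (fun L : (Fin d → ℝ) →ₗ[ℝ] (Fin d → ℝ) => L (Pi.single i 1)) hπ
    simpa using this
  let M : Matrix (Fin d) (Fin d) ℝ := Matrix.of fun i => - π (v i)
  refine (Polynomial.rootSet_finite M.charpoly ℝ).subset fun s hs => ?_
  rw [Polynomial.mem_rootSet_of_ne (Matrix.charpoly_monic M).ne_zero]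
  by_contra hne
  apply hs
  have hdet : (Matrix.scalar (Fin d) s - M).det ≠ 0 := by
    rw [← Matrix.eval_charpoly]
    simpa using hne
  refine LinearIndependent.of_comp π ?_
  have hrow : (π ∘ fun i => v i + s • e i) = (Matrix.scalar (Fin d) s - M).row := by
    funext i
    ext j
    simp [M, hπ, Matrix.diagonal_apply, Pi.single_apply, eq_comm, add_comm]
  rw [hrow]
  exact Matrix.linearIndependent_rows_of_det_ne_zero hdet

variable [FiniteDimensional ℝ F]

/-- On the line through `ξ` in a direction whose own first `d` derivatives are independent, only
finitely many points are degenerate, so small nonzero parameters approach `ξ` through good jets. -/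
theorem mem_closure_derivIndependent {d : ℕ} (hd : d ≤ r) (hF : d ≤ Module.finrank ℝ F)
    {U : Set (ℝ × (Fin (r + 1) → F))} (hU : IsOpen U) {ξ : ℝ × (Fin (r + 1) → F)} (hξ : ξ ∈ U) :
    ξ ∈ closure (U ∩ {ξ | DerivIndependent d ξ}) := by
  let b := Module.finBasis ℝ F
  let e : Fin d → F := fun i => b (Fin.castLE hF i)
  have he : LinearIndependent ℝ e := b.linearIndependent.comp _ (Fin.castLE_injective hF)
  let η : ℝ × (Fin (r + 1) → F) :=
    (0, fun k => if h : 1 ≤ (k : ℕ) ∧ (k : ℕ) ≤ d then e ⟨(k : ℕ) - 1, by omega⟩ else 0)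
  have hη : ∀ i : Fin d, coord η (i + 1) = e i := by
    intro i
    have hi := i.isLt
    rw [coord_of_le _ (by omega)]
    have : 1 ≤ (i : ℕ) + 1 ∧ (i : ℕ) + 1 ≤ d := by omega
    simp [η, hi]
  have hfin := finite_not_linearIndependent_add_smul (fun i : Fin d => coord ξ (i + 1)) he
  have h1 : ∀ᶠ s in nhdsWithin (0 : ℝ) {0}ᶜ, DerivIndependent d (ξ + s • η) := by
    have h2 : ∀ᶠ s in nhdsWithin (0 : ℝ) {0}ᶜ,
        s ∈ ({s : ℝ | ¬ LinearIndependent ℝ (fun i : Fin d => coord ξ (i + 1) + s • e i)} \ {0})ᶜ :=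
      mem_nhdsWithin_of_mem_nhds
        ((hfin.subset sdiff_subset).isClosed.isOpen_compl.mem_nhds (by simp))
    filter_upwards [h2, self_mem_nhdsWithin] with s hs hs0
    have h3 : LinearIndependent ℝ (fun i : Fin d => coord ξ (i + 1) + s • e i) := by
      by_contra h
      exact hs ⟨h, hs0⟩
    unfold DerivIndependent
    convert h3 using 2 with i
    rw [← hη i, ← coordL_apply, ← coordL_apply, ← coordL_apply, map_add, map_smul]
  have hcont : Filter.Tendsto (fun s : ℝ => ξ + s • η) (nhds 0) (nhds ξ) := by
    have : Continuous (fun s : ℝ => ξ + s • η) := by fun_prop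
    simpa using this.tendsto 0
  have hcont' := hcont.mono_left (nhdsWithin_le_nhds (s := {0}ᶜ))
  refine mem_closure_of_tendsto hcont' ?_
  filter_upwards [h1, hcont'.eventually (hU.mem_nhds hξ)] with s h1 h2
  exact ⟨h2, h1⟩

/-- Derivatives of order at least `m` impose no further condition: if a skew map kills `m - 1`
members of a basis, the image of the last member is orthogonal to all of them and to that member
itself, so it is zero. -/
theorem finrank_range_killingMap_of_derivIndependent {m : ℕ} (hm : Module.finrank ℝ F = m)
    (ξ : ℝ × (Fin (r + 1) → F)) (h : DerivIndependent (min r (m - 1)) ξ) :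
    Module.finrank ℝ (LinearMap.range (killingMap ξ))
      = m + Fintype.card (SkewIndex m (min r (m - 1))) := by
  have hd : min r (m - 1) ≤ m := by omega
  obtain ⟨b, hb⟩ := exists_basis_extending hm hd h
  refine finrank_range_killingMap ξ b fun A hA => ⟨fun h0 i hi => ?_, fun h0 k hk => ?_⟩
  · have h1 : b i = coord ξ (i + 1) := hb ⟨i, hi⟩
    rw [h1, coord_of_le _ (by omega)]
    exact h0 _ (Nat.succ_ne_zero _)
  · by_cases hkd : (k : ℕ) ≤ min r (m - 1)
    · have h1 := hb ⟨k - 1, by omega⟩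
      have h2 : (k : ℕ) - 1 + 1 = k := by omega
      simp only [h2, coord_val] at h1
      rw [← h1]
      exact h0 _ (by simp only [Fin.val_castLE]; omega)
    · have hk' := k.isLt
      have hd' : min r (m - 1) = m - 1 := by omega
      rw [hd'] at h0
      suffices A.toLinearMap = 0 from congrArg (fun L : F →ₗ[ℝ] F => L (ξ.2 k)) this
      refine b.ext fun i => ?_
      rw [LinearMap.zero_apply]
      by_cases hi : (i : ℕ) < m - 1
      · exact h0 i hi
      · refine InnerProductSpace.ext_inner_right_basis b fun j => ?_
        rw [inner_zero_left]
        by_cases hj : (j : ℕ) < m - 1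
        · have := inner_skew_apply hA (b i) (b j)
          rw [h0 j hj, inner_zero_right, neg_zero] at this
          exact this
        · have : i = j := Fin.ext (by omega)
          rw [this]
          exact inner_skew_self hA _

end Jets

theorem finrank_killingDistribution (ξ : Jet m r) (h : DerivIndependent (min r (m - 1)) ξ) :
    Module.finrank ℝ (killingDistribution ξ)
      = m + Fintype.card (SkewIndex m (min r (m - 1))) := by
  rw [killingDistribution_eq_range]
  exact finrank_range_killingMap_of_derivIndependent finrank_euclideanSpace_fin ξ h

theorem derivIndependent_jet {σ : ℝ → E m} {t : ℝ} (h : IsFrenetAt σ t) :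
    DerivIndependent (min r (m - 1)) (jet r σ t) := by
  have h1 := LinearIndependent.comp h (Fin.castLE (min_le_right r (m - 1)))
    (Fin.castLE_injective _)
  have h2 : (fun i : Fin (min r (m - 1)) => coord (jet r σ t) ((i : ℕ) + 1)) =
      (fun k : Fin (m - 1) => iteratedDeriv ((k : ℕ) + 1) σ t) ∘
        Fin.castLE (min_le_right r (m - 1)) :=
    funext fun i => coord_jet σ t (by have := i.isLt; omega)
  unfold DerivIndependent
  rw [h2]
  exact h1

theorem finrank_jet (m r : ℕ) : Module.finrank ℝ (Jet m r) = 1 + (r + 1) * m := by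
  rw [Module.finrank_prod, Module.finrank_pi_fintype]
  simp

/-! ### Inner products of derivatives and the number of invariants -/

/-- Index pairs of the inner products `⟨x_{i+1}, x_{j+1}⟩`, `i ≤ j < r`, `i < m`. -/
abbrev GramIndex (m r : ℕ) : Type := {p : Fin m × Fin r // (p.1 : ℕ) ≤ p.2}

/-- Swapping the entries identifies `SkewIndex` with the complement of `GramIndex` in `Fin m × Fin
r`; the bound by `m - 1` is automatic for the smaller of two indices below `m`. Hence the inner
products and `t` are exactly as many as the codimension. -/
theorem card_gramIndex_add (m r : ℕ) :
    Fintype.card (GramIndex m r) + Fintype.card (SkewIndex m (min r (m - 1))) = m * r := by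
  have e : SkewIndex m (min r (m - 1)) ≃ {p : Fin m × Fin r // ¬ (p.1 : ℕ) ≤ p.2} :=
    { toFun := fun p => ⟨(p.1.2, ⟨p.1.1, lt_of_lt_of_le p.2.2 (min_le_left _ _)⟩),
        not_le.2 p.2.1⟩
      invFun := fun p => ⟨(⟨p.1.2, (not_le.1 p.2).trans p.1.1.isLt⟩, p.1.1), not_le.1 p.2, by
        have h1 := p.2
        have h2 := p.1.1.isLt
        have h3 := p.1.2.isLt
        simp only
        omega⟩
      left_inv := fun _ => rfl
      right_inv := fun _ => rfl }
  rw [Fintype.card_congr e, Fintype.card_subtype_compl, Fintype.card_prod, Fintype.card_fin,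
    Fintype.card_fin]
  have : Fintype.card (GramIndex m r) ≤ m * r := by
    simpa using Fintype.card_subtype_le (fun p : Fin m × Fin r => (p.1 : ℕ) ≤ p.2)
  exact Nat.add_sub_of_le this

/-- The inner products of derivatives. -/
def gramFun (p : GramIndex m r) (ξ : Jet m r) : ℝ :=
  inner ℝ (coord ξ (p.1.1 + 1)) (coord ξ (p.1.2 + 1))

theorem contDiff_gramFun (p : GramIndex m r) : ContDiff ℝ ∞ (gramFun p) :=
  (contDiff_coord _).inner ℝ (contDiff_coord _)

theorem fderiv_gramFun_apply (p : GramIndex m r) (ξ V : Jet m r) :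
    fderiv ℝ (gramFun p) ξ V = inner ℝ (coord ξ (p.1.1 + 1)) (coord V (p.1.2 + 1))
      + inner ℝ (coord V (p.1.1 + 1)) (coord ξ (p.1.2 + 1)) := by
  have h : ∀ k, HasFDerivAt (fun ξ : Jet m r => coord ξ k) (coordL (E m) r k) ξ := by
    intro k
    simp only [← coordL_apply]
    exact (coordL (E m) r k).hasFDerivAt
  have := ((h (p.1.1 + 1)).inner ℝ (h (p.1.2 + 1))).fderiv
  unfold gramFun
  rw [this]
  simp only [ContinuousLinearMap.comp_apply, ContinuousLinearMap.prod_apply,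
    fderivInnerCLM_apply, coordL_apply]

/-- The family of invariants `t` and `⟨x_i, x_j⟩`. -/
def gramFamily (m r : ℕ) (a : Option (GramIndex m r)) (ξ : Jet m r) : ℝ :=
  a.elim ξ.1 (fun p => gramFun p ξ)

theorem isDifferentialInvariantOn_fst (U : Set (Jet m r)) :
    IsDifferentialInvariantOn U (fun ξ : Jet m r => ξ.1) := by
  refine ⟨contDiff_fst.contDiffOn, fun ξ _ V hV => ?_⟩
  exact fderiv_apply_of_mem_killingDistribution differentiableAt_fst (fun _ => rfl)
    (fun _ _ _ => rfl) hV

theorem isDifferentialInvariantOn_gramFamily (U : Set (Jet m r)) (a : Option (GramIndex m r)) :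
    IsDifferentialInvariantOn U (gramFamily m r a) := by
  rcases a with _ | p
  · exact isDifferentialInvariantOn_fst U
  · refine ⟨(contDiff_gramFun p).contDiffOn, fun ξ _ V hV => ?_⟩
    refine fderiv_apply_of_mem_killingDistribution
      (((contDiff_gramFun p).differentiable (by simp)) ξ) (fun b => ?_) (fun A hA s => ?_) hV
    · simp only [gramFun, coord_affineAct_succ,
        ContinuousLinearMap.id_apply]
    · simp only [gramFun, coord_affineAct_succ, inner_exp_smul_apply hA]

/-- Along its highest derivative `x_{j+1}`, the differential of `⟨x_{i+1}, x_{j+1}⟩` is the pairing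
with `x_{i+1}`, doubled if `i = j`. For fixed `j` these are distinct members of the first `min r m`
derivatives. -/
theorem functionallyIndependentOn_gramFamily :
    FunctionallyIndependentOn {ξ : Jet m r | DerivIndependent (min r m) ξ} (gramFamily m r) := by
  intro ξ hξ
  let w : GramIndex m r → E m := fun p =>
    (if (p.1.1 : ℕ) = p.1.2 then (2 : ℝ) else 1) • coord ξ (p.1.1 + 1)
  have h := linearIndependent_of_top_order (fun p => fderiv ℝ (gramFun p) ξ)
    (fun p : GramIndex m r => p.1.2.succ) w (fun p k v hk => ?_) (fun p v => ?_) (fun k => ?_)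
  · convert h using 2 with a
    rcases a with _ | p
    · exact fderiv_fst
    · rfl
  · have hp := p.2
    have hk' : (p.1.2 : ℕ) + 1 < k := hk
    rw [fderiv_gramFun_apply, coord_single, coord_single, if_neg (by omega), if_neg (by omega),
      inner_zero_left, inner_zero_right, add_zero]
  · rw [fderiv_gramFun_apply, coord_single, coord_single]
    have hp := p.2
    simp only [w, Fin.val_succ, if_true, real_inner_smul_left]
    by_cases he : (p.1.1 : ℕ) = p.1.2
    · simp only [he, if_true]
      rw [real_inner_comm v]
      ring
    · have : ¬ ((p.1.1 : ℕ) + 1 = p.1.2 + 1) := by omega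
      simp only [he, this, if_false, inner_zero_left]
      ring
  · have hinj : Function.Injective (fun p : {p : GramIndex m r // p.1.2.succ = k} =>
        (⟨p.1.1.1, by have h1 := p.1.2; have h2 := p.1.1.1.isLt; have h3 := p.1.1.2.isLt; omega⟩ :
          Fin (min r m))) := by
      intro p q hpq
      have h1 : (p.1.1.1 : ℕ) = q.1.1.1 := Fin.mk.inj_iff.1 hpq
      have h2 : p.1.1.2 = q.1.1.2 := Fin.succ_injective _ (p.2.trans q.2.symm)
      exact Subtype.ext (Subtype.ext (Prod.ext (Fin.ext h1) h2))
    have h1 := LinearIndependent.comp hξ _ hinj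
    have h2 := h1.units_smul (fun p => if (p.1.1.1 : ℕ) = p.1.1.2 then
      Units.mk0 (2 : ℝ) two_ne_zero else 1)
    convert h2 using 2 with p
    simp only [w, Pi.smul_apply', Function.comp]
    split_ifs <;> rfl

/-- The number of functionally independent differential invariants. -/
theorem isNumberOfInvariants_card (m r : ℕ) :
    IsNumberOfInvariants m r (Fintype.card (GramIndex m r) + 1) := by
  intro U hU hne
  have hfr : Module.finrank ℝ (E m) = m := finrank_euclideanSpace_fin
  constructor
  · let e : Fin (Fintype.card (GramIndex m r) + 1) ≃ Option (GramIndex m r) :=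
      (Fintype.equivFinOfCardEq (Fintype.card_option)).symm
    refine ⟨fun i => gramFamily m r (e i), fun i => isDifferentialInvariantOn_gramFamily U _,
      U ∩ {ξ | DerivIndependent (min r m) ξ}, hU.inter (isOpen_derivIndependent _),
      inter_subset_left, fun ξ hξ => mem_closure_derivIndependent (min_le_left _ _)
        (by rw [hfr]; exact min_le_right _ _) hU hξ, fun ξ hξ => ?_⟩
    exact (functionallyIndependentOn_gramFamily ξ hξ.2).comp e e.injective
  · rintro k ⟨f, hf, O, hO, hOU, hcl, hind⟩
    obtain ⟨ξ₀, hξ₀⟩ := hne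
    obtain ⟨ξ₁, hξ₁⟩ := closure_nonempty_iff.1 ⟨ξ₀, hcl hξ₀⟩
    -- The open set `O` contains a jet in general position, and there the codimension of the
    -- distribution bounds `k`.
    obtain ⟨ξ, hξO, hξ⟩ := closure_nonempty_iff.1 ⟨ξ₁,
      mem_closure_derivIndependent (d := min r (m - 1)) (min_le_left _ _)
        (by rw [hfr]; omega) hO hξ₁⟩
    have h1 := card_add_finrank_le (hind ξ hξO) (killingDistribution ξ)
      (fun i V hV => (hf i).2 ξ (hOU hξO) V hV)
    rw [finrank_killingDistribution ξ hξ, finrank_jet, Fintype.card_fin] at h1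
    have h2 := card_gramIndex_add m r
    have h3 : (r + 1) * m = m * r + m := by ring
    omega

/-! ### Gram–Schmidt: recursion, equivariance and smoothness -/

section GramSchmidt

open InnerProductSpace

variable {F : Type*} [NormedAddCommGroup F] [InnerProductSpace ℝ F]

/-- No independence is needed, since a vanishing Gram–Schmidt vector normalises to zero and
contributes no projection. -/
theorem gramSchmidt_eq_sub_sum (x : ℕ → F) (n : ℕ) :
    gramSchmidt ℝ x n = x n - ∑ j ∈ Finset.range n,
      inner ℝ (gramSchmidtNormed ℝ x j) (x n) • gramSchmidtNormed ℝ x j := by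
  rw [eq_sub_iff_add_eq]
  conv_rhs => rw [gramSchmidt_def'' ℝ x n]
  congr 1
  have : Finset.Iio n = Finset.range n := by ext; simp
  rw [this]
  refine Finset.sum_congr rfl fun j _ => ?_
  simp only [gramSchmidtNormed, real_inner_smul_left, smul_smul]
  congr 1
  simp
  ring

theorem gramSchmidtNormed_eq (x : ℕ → F) (n : ℕ) :
    gramSchmidtNormed ℝ x n = ‖gramSchmidt ℝ x n‖⁻¹ • gramSchmidt ℝ x n := rfl

theorem gramSchmidt_congr {x y : ℕ → F} {n : ℕ} (h : ∀ j ≤ n, x j = y j) :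
    gramSchmidt ℝ x n = gramSchmidt ℝ y n := by
  induction n using Nat.strong_induction_on with
  | _ n ih =>
    rw [gramSchmidt_eq_sub_sum, gramSchmidt_eq_sub_sum, h n le_rfl]
    congr 1
    refine Finset.sum_congr rfl fun j hj => ?_
    have hj := Finset.mem_range.1 hj
    rw [gramSchmidtNormed_eq, gramSchmidtNormed_eq, ih j hj fun i hi => h i (hi.trans hj.le)]

theorem gramSchmidtNormed_congr {x y : ℕ → F} {n : ℕ} (h : ∀ j ≤ n, x j = y j) :
    gramSchmidtNormed ℝ x n = gramSchmidtNormed ℝ y n := by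
  rw [gramSchmidtNormed_eq, gramSchmidtNormed_eq, gramSchmidt_congr h]

theorem gramSchmidtNormed_map {L : F →L[ℝ] F} (hL : ∀ u v, inner ℝ (L u) (L v) = inner ℝ u v)
    (x : ℕ → F) (n : ℕ) :
    gramSchmidtNormed ℝ (fun j => L (x j)) n = L (gramSchmidtNormed ℝ x n) := by
  have hn : ∀ u, ‖L u‖ = ‖u‖ := fun u => by
    rw [norm_eq_sqrt_real_inner, norm_eq_sqrt_real_inner, hL]
  induction n using Nat.strong_induction_on with
  | _ n ih =>
    have h1 : gramSchmidt ℝ (fun j => L (x j)) n = L (gramSchmidt ℝ x n) := by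
      rw [gramSchmidt_eq_sub_sum, gramSchmidt_eq_sub_sum, map_sub, map_sum]
      congr 1
      refine Finset.sum_congr rfl fun j hj => ?_
      rw [ih j (Finset.mem_range.1 hj), hL, map_smul]
    rw [gramSchmidtNormed_eq, gramSchmidtNormed_eq, h1, hn, map_smul]

theorem gramSchmidt_ne_zero_of_lt {x : ℕ → F} {d n : ℕ}
    (h : LinearIndependent ℝ (fun i : Fin d => x i)) (hn : n < d) : gramSchmidt ℝ x n ≠ 0 := by
  refine gramSchmidt_ne_zero_coe n ?_
  exact h.comp (fun i : Set.Iic n => (⟨i.1, lt_of_le_of_lt i.2 hn⟩ : Fin d))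
    (fun i j hij => Subtype.ext (Fin.mk.inj_iff.1 hij))

theorem inner_gramSchmidtNormed_self {x : ℕ → F} {n : ℕ} :
    inner ℝ (gramSchmidtNormed ℝ x n) (x n) = ‖gramSchmidt ℝ x n‖ := by
  have h0 : x n = gramSchmidt ℝ x n + ∑ j ∈ Finset.range n,
      inner ℝ (gramSchmidtNormed ℝ x j) (x n) • gramSchmidtNormed ℝ x j := by
    rw [gramSchmidt_eq_sub_sum, sub_add_cancel]
  rw [h0, inner_add_right, inner_sum, Finset.sum_eq_zero, add_zero]
  · rw [gramSchmidtNormed_eq, real_inner_smul_left, real_inner_self_eq_norm_sq]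
    by_cases h : ‖gramSchmidt ℝ x n‖ = 0
    · simp [h]
    · field_simp
  · intro j hj
    have hj := Finset.mem_range.1 hj
    rw [real_inner_smul_right, gramSchmidtNormed_eq x n, gramSchmidtNormed_eq x j]
    simp only [real_inner_smul_left, real_inner_smul_right, gramSchmidt_orthogonal ℝ x hj.ne',
      mul_zero]

theorem inner_gramSchmidtNormed_of_lt {x : ℕ → F} {j n : ℕ} (h : j < n) :
    inner ℝ (gramSchmidtNormed ℝ x n) (x j) = 0 := by
  rw [gramSchmidtNormed_eq, real_inner_smul_left, gramSchmidt_inv_triangular ℝ x h, mul_zero]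

theorem inner_gramSchmidtNormed {x : ℕ → F} {d i j : ℕ}
    (h : LinearIndependent ℝ (fun i : Fin d => x i)) (hi : i < d) :
    inner ℝ (gramSchmidtNormed ℝ x i) (gramSchmidtNormed ℝ x j) = if i = j then 1 else 0 := by
  split_ifs with hij
  · subst hij
    have h0 := norm_ne_zero_iff.2 (gramSchmidt_ne_zero_of_lt h hi)
    rw [gramSchmidtNormed_eq, real_inner_smul_left, real_inner_smul_right,
      real_inner_self_eq_norm_sq]
    field_simp
  · rw [gramSchmidtNormed_eq, gramSchmidtNormed_eq, real_inner_smul_left, real_inner_smul_right,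
      gramSchmidt_orthogonal ℝ x hij]
    ring

/-- Only the earlier vectors are normalised in the recursion, so only they have to avoid the origin,
where the norm is not smooth; the `n`-th one may vanish. -/
theorem contDiffAt_gramSchmidt {Z : Type*} [NormedAddCommGroup Z] [NormedSpace ℝ Z]
    {x : Z → ℕ → F} {z : Z} {n : ℕ} (hx : ∀ j ≤ n, ContDiffAt ℝ ∞ (fun y => x y j) z)
    (h0 : ∀ j < n, gramSchmidt ℝ (x z) j ≠ 0) :
    ContDiffAt ℝ ∞ (fun y => gramSchmidt ℝ (x y) n) z := by
  induction n using Nat.strong_induction_on with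
  | _ n ih =>
    simp only [gramSchmidt_eq_sub_sum]
    refine (hx n le_rfl).sub (ContDiffAt.sum fun j hj => ?_)
    have hj := Finset.mem_range.1 hj
    have h1 := ih j hj (fun i hi => hx i (hi.trans hj.le)) (fun i hi => h0 i (hi.trans hj))
    have h2 : ContDiffAt ℝ ∞ (fun y => gramSchmidtNormed ℝ (x y) j) z := by
      simp only [gramSchmidtNormed_eq]
      exact ((h1.norm ℝ (h0 j hj)).inv (norm_ne_zero_iff.2 (h0 j hj))).smul h1
    exact (h2.inner ℝ (hx n le_rfl)).smul h2

theorem contDiffAt_gramSchmidtNormed {Z : Type*} [NormedAddCommGroup Z] [NormedSpace ℝ Z]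
    {x : Z → ℕ → F} {z : Z} {n : ℕ} (hx : ∀ j ≤ n, ContDiffAt ℝ ∞ (fun y => x y j) z)
    (h0 : ∀ j ≤ n, gramSchmidt ℝ (x z) j ≠ 0) :
    ContDiffAt ℝ ∞ (fun y => gramSchmidtNormed ℝ (x y) n) z := by
  have h1 := contDiffAt_gramSchmidt hx (fun j hj => h0 j hj.le)
  simp only [gramSchmidtNormed_eq]
  exact ((h1.norm ℝ (h0 n le_rfl)).inv (norm_ne_zero_iff.2 (h0 n le_rfl))).smul h1

end GramSchmidt

/-! ### Oriented volume and the cross product of `m - 1` vectors -/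

section Cross

theorem update_restrict (hm : 0 < m) {F : Type*} (v : ℕ → F) (w : F) :
    (fun i : Fin m => Function.update v (m - 1) w i)
      = Function.update (fun i : Fin m => v i) ⟨m - 1, by omega⟩ w := by
  funext i
  by_cases h : i = ⟨m - 1, by omega⟩
  · subst h; simp
  · have : (i : ℕ) ≠ m - 1 := fun e => h (Fin.ext e)
    simp [h, this]

variable {F : Type*} [NormedAddCommGroup F] [InnerProductSpace ℝ F] 
  (B : OrthonormalBasis (Fin m) ℝ F)

/-- The oriented volume of the first `m` vectors of a sequence. -/
def vol (v : ℕ → F) : ℝ := B.toBasis.det (fun i : Fin m => v i)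

/-- The vector dual to `w ↦ vol (v_0, …, v_{m-2}, w)`. -/
def cross (v : ℕ → F) : F := ∑ i, vol B (Function.update v (m - 1) (B i)) • B i

theorem vol_update_sum (hm : 0 < m) (v : ℕ → F) {ι : Type*} (s : Finset ι) (c : ι → ℝ) (w : ι → F) :
    vol B (Function.update v (m - 1) (∑ i ∈ s, c i • w i))
      = ∑ i ∈ s, c i * vol B (Function.update v (m - 1) (w i)) := by
  have h : ∀ w, vol B (Function.update v (m - 1) w) =
      B.toBasis.det.toMultilinearMap.toLinearMap (fun i : Fin m => v i) ⟨m - 1, by omega⟩ w := by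
    intro w
    rw [vol, update_restrict hm]
    rfl
  simp only [h, map_sum, map_smul, smul_eq_mul]

theorem inner_cross (hm : 0 < m) (v : ℕ → F) (w : F) :
    inner ℝ (cross B v) w = vol B (Function.update v (m - 1) w) := by
  conv_rhs => rw [← B.sum_repr' w, vol_update_sum B hm]
  rw [cross, sum_inner]
  refine Finset.sum_congr rfl fun i _ => ?_
  rw [real_inner_smul_left, mul_comm]

theorem vol_congr {v w : ℕ → F} (h : ∀ i < m, v i = w i) : vol B v = vol B w := by
  unfold vol
  congr 1
  funext i
  exact h i i.isLt

theorem vol_eq_zero {v : ℕ → F} {i j : ℕ} (hi : i < m) (hj : j < m) (hij : i ≠ j)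
    (h : v i = v j) : vol B v = 0 :=
  B.toBasis.det.map_eq_zero_of_eq (fun i : Fin m => v i) (i := ⟨i, hi⟩) (j := ⟨j, hj⟩) h
    (fun e => hij (Fin.mk.inj_iff.1 e))

/-- The slot `m - 1` is overwritten in the definition. For this reason the last frame vector depends
only on the first `m - 1` derivatives. -/
theorem cross_congr {v w : ℕ → F} (h : ∀ i < m - 1, v i = w i) : cross B v = cross B w := by
  unfold cross
  refine Finset.sum_congr rfl fun k _ => ?_
  congr 1
  refine vol_congr B fun i hi => ?_
  by_cases hi' : i = m - 1
  · simp [hi']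
  · simp only [Function.update_of_ne hi']
    exact h i (by omega)

theorem inner_cross_of_lt {v : ℕ → F} {j : ℕ} (hj : j + 1 < m) :
    inner ℝ (cross B v) (v j) = 0 := by
  rw [inner_cross B (by omega)]
  refine vol_eq_zero B (i := m - 1) (j := j) (by omega) (by omega) (by omega) ?_
  rw [Function.update_self, Function.update_of_ne (by omega)]

theorem vol_map (L : F →L[ℝ] F) (v : ℕ → F) :
    vol B (fun i => L (v i)) = LinearMap.det L.toLinearMap * vol B v :=
  B.toBasis.det_comp L.toLinearMap (fun i : Fin m => v i)

/-- An orthonormal family of full cardinality, as an orthonormal basis. -/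
theorem exists_orthonormalBasis_coe (B : OrthonormalBasis (Fin m) ℝ F) {v : ℕ → F} (hv : Orthonormal ℝ (fun i : Fin m => v i)) :
    ∃ b : OrthonormalBasis (Fin m) ℝ F, ∀ i : Fin m, b i = v i := by
  have : FiniteDimensional ℝ F := Module.Finite.of_basis B.toBasis
  have hs : ⊤ ≤ Submodule.span ℝ (range fun i : Fin m => v i) :=
    (hv.linearIndependent.span_eq_top_of_card_eq_finrank'
      (Module.finrank_eq_card_basis B.toBasis).symm).ge
  exact ⟨OrthonormalBasis.mk hv hs, fun i => by rw [OrthonormalBasis.coe_mk]⟩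

theorem vol_sq_of_orthonormal {v : ℕ → F} (hv : Orthonormal ℝ (fun i : Fin m => v i)) :
    vol B v ^ 2 = 1 := by
  obtain ⟨b, hb⟩ := exists_orthonormalBasis_coe B hv
  have := B.det_to_matrix_orthonormalBasis_real b
  rw [show (b : Fin m → F) = fun i : Fin m => v i from funext hb] at this
  rcases this with h | h <;> rw [vol, h] <;> norm_num

/-- Expansion in an orthonormal family of full cardinality. -/
theorem sum_inner_smul_eq (B : OrthonormalBasis (Fin m) ℝ F) {v : ℕ → F} (hv : Orthonormal ℝ (fun i : Fin m => v i)) (w : F) :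
    ∑ i ∈ Finset.range m, inner ℝ (v i) w • v i = w := by
  obtain ⟨b, hb⟩ := exists_orthonormalBasis_coe B hv
  rw [Finset.sum_range]
  simp only [← hb]
  exact b.sum_repr' w

theorem cross_eq_of_orthonormal (hm : 0 < m) {v : ℕ → F}
    (hv : Orthonormal ℝ (fun i : Fin m => v i)) : cross B v = vol B v • v (m - 1) := by
  refine ext_inner_right ℝ fun w => ?_
  rw [inner_cross B hm, real_inner_smul_left]
  conv_lhs => rw [← sum_inner_smul_eq B hv w]
  rw [vol_update_sum B hm, Finset.sum_eq_single (m - 1)]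
  · rw [Function.update_eq_self, mul_comm]
  · intro j hj hne
    have hj := Finset.mem_range.1 hj
    rw [vol_eq_zero B (i := m - 1) (j := j) (by omega) hj (Ne.symm hne), mul_zero]
    rw [Function.update_self, Function.update_of_ne hne]
  · intro h; exact absurd (Finset.mem_range.2 (by omega)) h

/-- Every test vector has the form `L w`, because `L` is invertible; pairing with it reduces the
claim to the behaviour of the volume under `L`. -/
theorem cross_map (hm : 0 < m) {L : F →L[ℝ] F} (hL : ∀ u v, inner ℝ (L u) (L v) = inner ℝ u v)
    (hdet : LinearMap.det L.toLinearMap = 1) (v : ℕ → F) :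
    cross B (fun i => L (v i)) = L (cross B v) := by
  have hsurj : Function.Surjective L := by
    have : FiniteDimensional ℝ F := Module.Finite.of_basis B.toBasis
    exact (LinearMap.equivOfDetNeZero L.toLinearMap (by rw [hdet]; exact one_ne_zero)).surjective
  refine ext_inner_right ℝ fun w => ?_
  obtain ⟨w, rfl⟩ := hsurj w
  rw [hL, inner_cross B hm, inner_cross B hm]
  have : Function.update (fun i => L (v i)) (m - 1) (L w)
      = fun i => L (Function.update v (m - 1) w i) := by
    funext i
    by_cases h : i = m - 1
    · simp [h]
    · simp [Function.update_of_ne h]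
  rw [this, vol_map, hdet, one_mul]

theorem contDiffAt_vol {Z : Type*} [NormedAddCommGroup Z] [NormedSpace ℝ Z] {x : Z → ℕ → F}
    {z : Z} (hx : ∀ j < m, ContDiffAt ℝ ∞ (fun y => x y j) z) :
    ContDiffAt ℝ ∞ (fun y => vol B (x y)) z := by
  simp only [vol, Module.Basis.det_apply, Matrix.det_apply]
  refine ContDiffAt.sum fun σ _ => ContDiffAt.const_smul _ (contDiffAt_prod fun i _ => ?_)
  simp only [Module.Basis.toMatrix_apply, OrthonormalBasis.coe_toBasis_repr_apply,
    OrthonormalBasis.repr_apply_apply]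
  exact contDiffAt_const.inner ℝ (hx i i.isLt)

theorem contDiffAt_cross {Z : Type*} [NormedAddCommGroup Z] [NormedSpace ℝ Z] {x : Z → ℕ → F}
    {z : Z} (hx : ∀ j < m - 1, ContDiffAt ℝ ∞ (fun y => x y j) z) :
    ContDiffAt ℝ ∞ (fun y => cross B (x y)) z := by
  unfold cross
  refine ContDiffAt.sum fun i _ => (contDiffAt_vol B fun j hj => ?_).smul contDiffAt_const
  by_cases h : j = m - 1
  · simp only [h, Function.update_self]; exact contDiffAt_const
  · simp only [Function.update_of_ne h]; exact hx j (by omega)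

end Cross

/-! ### The Frenet frame and the curvatures as functions of the derivatives -/

section Frame

open InnerProductSpace

variable {F : Type*} [NormedAddCommGroup F] [InnerProductSpace ℝ F]
  (B : OrthonormalBasis (Fin m) ℝ F)

/-- The Frenet frame `X_1, …, X_m` (indexed from zero) of the derivatives `x_1, x_2, …` (indexed
from zero). -/
def frame (x : ℕ → F) (n : ℕ) : F :=
  if n + 1 < m then gramSchmidtNormed ℝ x n else cross B (gramSchmidtNormed ℝ x)

/-- The leading coefficient of `x_{n+1}` in the Frenet frame. -/
def rho (x : ℕ → F) (n : ℕ) : ℝ := inner ℝ (frame B x n) (x n)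

/-- The curvature `κ_n` as a function of the derivatives. -/
def kap (x : ℕ → F) (n : ℕ) : ℝ :=
  if n = 0 then rho B x 0 else rho B x n / (rho B x (n - 1) * rho B x 0)

theorem frame_of_lt (x : ℕ → F) {n : ℕ} (hn : n + 1 < m) :
    frame B x n = gramSchmidtNormed ℝ x n := if_pos hn

theorem frame_of_not_lt (x : ℕ → F) {n : ℕ} (hn : ¬ n + 1 < m) :
    frame B x n = cross B (gramSchmidtNormed ℝ x) := if_neg hn

theorem rho_of_lt (x : ℕ → F) {n : ℕ} (hn : n + 1 < m) : rho B x n = ‖gramSchmidt ℝ x n‖ := by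
  rw [rho, frame_of_lt B x hn, inner_gramSchmidtNormed_self]

theorem frame_congr {x y : ℕ → F} {n : ℕ} (hn : n < m) (h : ∀ j ≤ n, j < m - 1 → x j = y j) :
    frame B x n = frame B y n := by
  by_cases hn' : n + 1 < m
  · rw [frame_of_lt B _ hn', frame_of_lt B _ hn']
    exact gramSchmidtNormed_congr fun j hj => h j hj (by omega)
  · rw [frame_of_not_lt B _ hn', frame_of_not_lt B _ hn']
    refine cross_congr B fun i hi => gramSchmidtNormed_congr fun j hj => h j (by omega) (by omega)

theorem rho_congr {x y : ℕ → F} {n : ℕ} (hn : n < m) (h : ∀ j ≤ n, x j = y j) :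
    rho B x n = rho B y n := by
  rw [rho, rho, frame_congr B hn fun j hj _ => h j hj, h n le_rfl]

theorem kap_congr {x y : ℕ → F} {n : ℕ} (hn : n < m) (h : ∀ j ≤ n, x j = y j) :
    kap B x n = kap B y n := by
  unfold kap
  rw [rho_congr B (by omega) fun j hj => h j (by omega), rho_congr B hn h,
    rho_congr B (by omega) fun j hj => h j (hj.trans (Nat.sub_le n 1))]

theorem frame_map {L : F →L[ℝ] F} (hL : ∀ u v, inner ℝ (L u) (L v) = inner ℝ u v)
    (hdet : LinearMap.det L.toLinearMap = 1) (x : ℕ → F) {n : ℕ} (hn : n < m) :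
    frame B (fun j => L (x j)) n = L (frame B x n) := by
  have h1 : gramSchmidtNormed ℝ (fun j => L (x j)) = fun n => L (gramSchmidtNormed ℝ x n) :=
    funext fun n => gramSchmidtNormed_map hL x n
  unfold frame
  split_ifs
  · rw [h1]
  · rw [h1, cross_map B (by omega) hL hdet]

theorem rho_map {L : F →L[ℝ] F} (hL : ∀ u v, inner ℝ (L u) (L v) = inner ℝ u v)
    (hdet : LinearMap.det L.toLinearMap = 1) (x : ℕ → F) {n : ℕ} (hn : n < m) :
    rho B (fun j => L (x j)) n = rho B x n := by
  rw [rho, frame_map B hL hdet x hn, hL, rho]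

theorem kap_map {L : F →L[ℝ] F} (hL : ∀ u v, inner ℝ (L u) (L v) = inner ℝ u v)
    (hdet : LinearMap.det L.toLinearMap = 1) (x : ℕ → F) {n : ℕ} (hn : n < m) :
    kap B (fun j => L (x j)) n = kap B x n := by
  unfold kap
  rw [rho_map B hL hdet x hn, rho_map B hL hdet x (show n - 1 < m by omega),
    rho_map B hL hdet x (show 0 < m by omega)]

theorem sub_sum_gramSchmidtNormed (x : ℕ → F) (j : ℕ) :
    x j = ‖gramSchmidt ℝ x j‖ • gramSchmidtNormed ℝ x j + ∑ i ∈ Finset.range j,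
      inner ℝ (gramSchmidtNormed ℝ x i) (x j) • gramSchmidtNormed ℝ x i := by
  have h1 : ‖gramSchmidt ℝ x j‖ • gramSchmidtNormed ℝ x j = gramSchmidt ℝ x j := by
    rw [gramSchmidtNormed_eq, smul_smul]
    by_cases h : gramSchmidt ℝ x j = 0
    · rw [h, smul_zero]
    · rw [mul_inv_cancel₀ (norm_ne_zero_iff.2 h), one_smul]
  rw [h1, gramSchmidt_eq_sub_sum, sub_add_cancel]

theorem inner_frame_of_lt (x : ℕ → F) {j n : ℕ} (hj : j < n) (hn : n < m) :
    inner ℝ (frame B x n) (x j) = 0 := by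
  by_cases hn' : n + 1 < m
  · rw [frame_of_lt B _ hn', inner_gramSchmidtNormed_of_lt hj]
  · rw [frame_of_not_lt B _ hn', sub_sum_gramSchmidtNormed x j, inner_add_right, inner_sum,
      real_inner_smul_right, inner_cross_of_lt B (by omega), mul_zero, zero_add]
    refine Finset.sum_eq_zero fun i hi => ?_
    have hi := Finset.mem_range.1 hi
    rw [real_inner_smul_right, inner_cross_of_lt B (by omega), mul_zero]

theorem rho_pos {x : ℕ → F} {d n : ℕ} (h : LinearIndependent ℝ (fun i : Fin d => x i))
    (hd : n < d) (hn : n + 1 < m) : 0 < rho B x n := by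
  rw [rho_of_lt B x hn]
  exact norm_pos_iff.2 (gramSchmidt_ne_zero_of_lt h hd)

/-- The first `m - 1` normalised vectors extend to an orthonormal basis, and the cross product is
the last basis vector times a volume equal to `±1`. -/
theorem norm_cross_gramSchmidtNormed (hm : 0 < m) {x : ℕ → F}
    (h : LinearIndependent ℝ (fun i : Fin (m - 1) => x i)) :
    ‖cross B (gramSchmidtNormed ℝ x)‖ = 1 := by
  have : FiniteDimensional ℝ F := Module.Finite.of_basis B.toBasis
  have hcard : Module.finrank ℝ F = Fintype.card (Fin m) := Module.finrank_eq_card_basis B.toBasis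
  have hon : Orthonormal ℝ (({i : Fin m | (i : ℕ) < m - 1} : Set (Fin m)).domRestrict
      (fun i : Fin m => gramSchmidtNormed ℝ x i)) := by
    rw [orthonormal_iff_ite]
    intro i j
    refine (inner_gramSchmidtNormed h i.2).trans ?_
    congr 1
    rw [← Fin.ext_iff, ← Subtype.ext_iff]
  obtain ⟨b, hb⟩ := hon.exists_orthonormalBasis_extension_of_card_eq hcard
  let v : ℕ → F := fun n => if hn : n < m then b ⟨n, hn⟩ else 0
  have hv : (fun i : Fin m => v i) = b := by
    funext i
    simp [v]
  have hvo : Orthonormal ℝ (fun i : Fin m => v i) := hv ▸ b.orthonormal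
  have h1 : cross B (gramSchmidtNormed ℝ x) = cross B v := by
    refine cross_congr B fun i hi => ?_
    have : i < m := by omega
    simp only [v, this, dif_pos]
    exact (hb ⟨i, this⟩ hi).symm
  have h2 : ‖v (m - 1)‖ = 1 := hvo.1 ⟨m - 1, by omega⟩
  rw [h1, cross_eq_of_orthonormal B hm hvo, norm_smul, h2, mul_one, Real.norm_eq_abs]
  have h3 := vol_sq_of_orthonormal B hvo
  rw [← sq_abs] at h3
  nlinarith [abs_nonneg (vol B v)]

theorem orthonormal_frame {x : ℕ → F}
    (h : LinearIndependent ℝ (fun i : Fin (m - 1) => x i)) :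
    Orthonormal ℝ (fun i : Fin m => frame B x i) := by
  rw [orthonormal_iff_ite]
  intro i j
  have hi' := i.isLt
  have hj' := j.isLt
  by_cases hi : (i : ℕ) + 1 < m <;> by_cases hj : (j : ℕ) + 1 < m
  · rw [frame_of_lt B _ hi, frame_of_lt B _ hj, inner_gramSchmidtNormed h (by omega)]
    simp only [Fin.ext_iff]
  · have : i ≠ j := fun e => hj (e ▸ hi)
    rw [frame_of_lt B _ hi, frame_of_not_lt B _ hj, real_inner_comm, inner_cross_of_lt B hi,
      if_neg this]
  · have : i ≠ j := fun e => hi (e ▸ hj)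
    rw [frame_of_lt B _ hj, frame_of_not_lt B _ hi, inner_cross_of_lt B hj, if_neg this]
  · have : i = j := Fin.ext (by omega)
    rw [frame_of_not_lt B _ hj, frame_of_not_lt B _ hi, real_inner_self_eq_norm_sq,
      norm_cross_gramSchmidtNormed B (by omega) h, if_pos this, one_pow]

/-- By duality, the volume with the cross product in the last slot is the squared norm of the cross
product. -/
theorem vol_frame (hm : 0 < m) {x : ℕ → F}
    (h : LinearIndependent ℝ (fun i : Fin (m - 1) => x i)) : vol B (frame B x) = 1 := by
  have h1 : vol B (frame B x) = vol B (Function.update (gramSchmidtNormed ℝ x) (m - 1)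
      (cross B (gramSchmidtNormed ℝ x))) := by
    refine vol_congr B fun i hi => ?_
    by_cases h : i = m - 1
    · rw [h, Function.update_self, frame_of_not_lt B _ (by omega)]
    · rw [Function.update_of_ne h, frame_of_lt B _ (by omega)]
  rw [h1, ← inner_cross B hm, real_inner_self_eq_norm_sq, norm_cross_gramSchmidtNormed B hm h,
    one_pow]

/-- An oriented orthonormal family in which the derivatives are upper triangular with positive
diagonal is the Frenet frame. -/
theorem eq_frame {x X : ℕ → F} (hX : Orthonormal ℝ (fun i : Fin m => X i)) (hvol : 0 < vol B X)
    (h0 : ∀ i j, j < i → i < m → j + 1 < m → inner ℝ (X i) (x j) = 0)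
    (hpos : ∀ j, j + 1 < m → 0 < inner ℝ (X j) (x j)) {n : ℕ} (hn : n < m) :
    X n = frame B x n := by
  have hnorm : ∀ i, i < m → ‖X i‖ = 1 := fun i hi => hX.1 ⟨i, hi⟩
  have key : ∀ n, n + 1 < m → X n = gramSchmidtNormed ℝ x n := by
    intro n
    induction n using Nat.strong_induction_on with
    | _ n ih =>
      intro hn
      -- By triangularity the expansion of `x n` in `X` stops at `n`. By induction its terms below
      -- `n` are the projections that Gram–Schmidt removes.
      have h1 : gramSchmidt ℝ x n = inner ℝ (X n) (x n) • X n := by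
        rw [gramSchmidt_eq_sub_sum, sub_eq_iff_eq_add]
        conv_lhs => rw [← sum_inner_smul_eq B hX (x n)]
        obtain ⟨c, hc⟩ : ∃ c, m = n + 1 + c := ⟨m - (n + 1), by omega⟩
        have h2 : ∑ i ∈ Finset.range m, inner ℝ (X i) (x n) • X i
            = ∑ i ∈ Finset.range (n + 1), inner ℝ (X i) (x n) • X i := by
          refine (Finset.sum_subset (Finset.range_mono (by omega)) fun i hi hi' => ?_).symm
          have hi := Finset.mem_range.1 hi
          rw [Finset.mem_range] at hi'
          rw [h0 i n (by omega) hi hn, zero_smul]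
        rw [h2, Finset.sum_range_succ, add_comm]
        congr 1
        refine Finset.sum_congr rfl fun i hi => ?_
        have hi := Finset.mem_range.1 hi
        rw [ih i hi (by omega)]
      rw [gramSchmidtNormed_eq, h1, norm_smul, hnorm n (by omega), mul_one,
        Real.norm_of_nonneg (hpos n hn).le, smul_smul, inv_mul_cancel₀ (hpos n hn).ne', one_smul]
  by_cases hn' : n + 1 < m
  · rw [frame_of_lt B _ hn', key n hn']
  -- The volume is `±1` by orthonormality and positive by hypothesis; this fixes the sign of the
  -- last vector.
  · have hv : vol B X = 1 := by
      have := vol_sq_of_orthonormal B hX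
      nlinarith
    have : n = m - 1 := by omega
    rw [frame_of_not_lt B _ hn', ← cross_congr B fun i hi => key i (by omega),
      cross_eq_of_orthonormal B (by omega) hX, hv, one_smul, this]

/-- The bound `min (n + 1) (m - 1)` covers both cases: a Gram–Schmidt vector needs the `n + 1`
derivatives entering it, while the last frame vector needs only `m - 1`. -/
theorem contDiffAt_frame {Z : Type*} [NormedAddCommGroup Z] [NormedSpace ℝ Z]
    {x : Z → ℕ → F} {z : Z} {n : ℕ} (hx : ∀ j ≤ n, ContDiffAt ℝ ∞ (fun y => x y j) z)
    (hn : n < m) (h : LinearIndependent ℝ (fun i : Fin (min (n + 1) (m - 1)) => x z i)) :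
    ContDiffAt ℝ ∞ (fun y => frame B (x y) n) z := by
  by_cases hn' : n + 1 < m
  · simp only [frame_of_lt B _ hn']
    exact contDiffAt_gramSchmidtNormed hx fun j hj => gramSchmidt_ne_zero_of_lt h (by omega)
  · simp only [frame_of_not_lt B _ hn']
    refine contDiffAt_cross B fun j hj => ?_
    exact contDiffAt_gramSchmidtNormed (fun i hi => hx i (by omega))
      fun i hi => gramSchmidt_ne_zero_of_lt h (by omega)

theorem contDiffAt_rho {Z : Type*} [NormedAddCommGroup Z] [NormedSpace ℝ Z]
    {x : Z → ℕ → F} {z : Z} {n : ℕ} (hx : ∀ j ≤ n, ContDiffAt ℝ ∞ (fun y => x y j) z)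
    (hn : n < m) (h : LinearIndependent ℝ (fun i : Fin (min (n + 1) (m - 1)) => x z i)) :
    ContDiffAt ℝ ∞ (fun y => rho B (x y) n) z :=
  (contDiffAt_frame B hx hn h).inner ℝ (hx n le_rfl)

theorem linearIndependent_fin_mono {x : ℕ → F} {d d' : ℕ}
    (h : LinearIndependent ℝ (fun i : Fin d => x i)) (hd : d' ≤ d) :
    LinearIndependent ℝ (fun i : Fin d' => x i) :=
  h.comp (Fin.castLE hd) (Fin.castLE_injective hd)

theorem rho_mul_ne_zero {x : ℕ → F} {n : ℕ} (hn0 : n ≠ 0) (hn : n < m)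
    (h : LinearIndependent ℝ (fun i : Fin (min (n + 1) (m - 1)) => x i)) :
    rho B x (n - 1) * rho B x 0 ≠ 0 :=
  mul_ne_zero (rho_pos B h (by omega) (by omega)).ne' (rho_pos B h (by omega) (by omega)).ne'

theorem contDiffAt_kap {Z : Type*} [NormedAddCommGroup Z] [NormedSpace ℝ Z]
    {x : Z → ℕ → F} {z : Z} {n : ℕ} (hx : ∀ j ≤ n, ContDiffAt ℝ ∞ (fun y => x y j) z)
    (hn : n < m) (h : LinearIndependent ℝ (fun i : Fin (min (n + 1) (m - 1)) => x z i)) :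
    ContDiffAt ℝ ∞ (fun y => kap B (x y) n) z := by
  have h' : ∀ k ≤ n, ContDiffAt ℝ ∞ (fun y => rho B (x y) k) z := fun k hk =>
    contDiffAt_rho B (fun j hj => hx j (hj.trans hk)) (lt_of_le_of_lt hk hn)
      (linearIndependent_fin_mono h (by omega))
  by_cases hn0 : n = 0
  · simp only [kap, hn0, if_true]
    exact h' 0 (Nat.zero_le _)
  · simp only [kap, hn0, if_false]
    exact (h' n le_rfl).div ((h' (n - 1) (Nat.sub_le _ _)).mul (h' 0 (Nat.zero_le _)))
      (rho_mul_ne_zero B hn0 hn h)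

theorem hasDerivAt_norm_add_smul {y q : F} (hy : y ≠ 0) :
    HasDerivAt (fun s : ℝ => ‖y + s • q‖) (inner ℝ (‖y‖⁻¹ • y) q) 0 := by
  have h1 : HasDerivAt (fun s : ℝ => y + s • q) q 0 := by
    simpa using ((hasDerivAt_id (0 : ℝ)).smul_const q).const_add y
  have h2 := h1.norm_sq
  have h3 := h2.sqrt (by simpa using hy)
  simp only [Real.sqrt_sq (norm_nonneg _), zero_smul, add_zero] at h3
  refine h3.congr_deriv ?_
  have : ‖y‖ ≠ 0 := norm_ne_zero_iff.2 hy
  rw [real_inner_smul_left]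
  field_simp

/-- The leading coefficient depends on the top order derivative through its component along the
frame. -/
theorem hasDerivAt_rho_update {x : ℕ → F} {n : ℕ} (hn : n < m)
    (h : LinearIndependent ℝ (fun i : Fin (min (n + 1) (m - 1)) => x i)) (v : F) :
    HasDerivAt (fun s : ℝ => rho B (Function.update x n (x n + s • v)) n)
      (inner ℝ (frame B x n) v) 0 := by
  have hlow : ∀ (w : F) (j : ℕ), j < n → gramSchmidtNormed ℝ (Function.update x n w) j
      = gramSchmidtNormed ℝ x j := fun w j hj =>
    gramSchmidtNormed_congr fun i hi => Function.update_of_ne (by omega) _ _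
  by_cases hn' : n + 1 < m
  · simp only [rho_of_lt B _ hn', frame_of_lt B _ hn']
    have h0 : gramSchmidt ℝ x n ≠ 0 := gramSchmidt_ne_zero_of_lt h (by omega)
    let q := v - ∑ j ∈ Finset.range n,
      inner ℝ (gramSchmidtNormed ℝ x j) v • gramSchmidtNormed ℝ x j
    -- The earlier vectors do not see `x n`, so the Gram–Schmidt vector moves linearly, by the part
    -- `q` of `v` left after removing their projections.
    have h1 : ∀ s : ℝ, gramSchmidt ℝ (Function.update x n (x n + s • v)) n
        = gramSchmidt ℝ x n + s • q := by
      intro s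
      rw [gramSchmidt_eq_sub_sum, gramSchmidt_eq_sub_sum, Function.update_self,
        Finset.sum_congr rfl fun j hj => by rw [hlow _ j (Finset.mem_range.1 hj)]]
      simp only [q, inner_add_right, real_inner_smul_right, add_smul, Finset.sum_add_distrib,
        smul_sub, Finset.smul_sum, smul_smul]
      abel
    simp only [h1]
    refine (hasDerivAt_norm_add_smul h0).congr_deriv ?_
    rw [← gramSchmidtNormed_eq]
    simp only [q, inner_sub_right, inner_sum, real_inner_smul_right]
    rw [Finset.sum_eq_zero, sub_zero]
    intro j hj
    have hj := Finset.mem_range.1 hj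
    rw [inner_gramSchmidtNormed h (by omega), if_neg hj.ne', mul_zero]
  -- For `n = m - 1` the frame vector does not involve `x n`, so the coefficient is affine in it.
  · have h1 : ∀ s : ℝ, rho B (Function.update x n (x n + s • v)) n
        = rho B x n + s * inner ℝ (frame B x n) v := by
      intro s
      have : frame B (Function.update x n (x n + s • v)) n = frame B x n :=
        frame_congr B hn fun j hj hj' => Function.update_of_ne (by omega) _ _
      rw [rho, this, Function.update_self, inner_add_right, real_inner_smul_right, rho]
    simp only [h1]
    simpa using ((hasDerivAt_id (0 : ℝ)).mul_const (inner ℝ (frame B x n) v)).const_add (rho B x n)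

/-- The denominator of `kap` has lower order, so only the numerator moves; `c` is `1` for `n = 0`
and the inverse of the denominator otherwise. -/
theorem exists_hasDerivAt_kap_update {x : ℕ → F} {n : ℕ} (hn : n < m)
    (h : LinearIndependent ℝ (fun i : Fin (min (n + 1) (m - 1)) => x i)) :
    ∃ c : ℝ, c ≠ 0 ∧ ∀ v, HasDerivAt (fun s : ℝ => kap B (Function.update x n (x n + s • v)) n)
      (c * inner ℝ (frame B x n) v) 0 := by
  by_cases hn0 : n = 0
  · subst hn0
    refine ⟨1, one_ne_zero, fun v => ?_⟩
    simp only [kap, if_true, one_mul]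
    exact hasDerivAt_rho_update B hn h v
  · refine ⟨(rho B x (n - 1) * rho B x 0)⁻¹, inv_ne_zero (rho_mul_ne_zero B hn0 hn h), fun v => ?_⟩
    have h1 : ∀ (w : F) (k : ℕ), k < n → rho B (Function.update x n w) k = rho B x k := fun w k hk =>
      rho_congr B (by omega) fun j hj => Function.update_of_ne (by omega) _ _
    simp only [kap, hn0, if_false]
    simp only [h1 _ (n - 1) (by omega), h1 _ 0 (by omega)]
    refine ((hasDerivAt_rho_update B hn h v).div_const _).congr_deriv ?_
    rw [div_eq_inv_mul]

end Frame

/-! ### Functional dependence from the inverse function theorem -/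

section Factorization

variable {V ι : Type*} [NormedAddCommGroup V] [NormedSpace ℝ V] [FiniteDimensional ℝ V] [Fintype ι]

/-- Locally, a function whose differential vanishes on the common kernel of the differentials of
independent functions is a smooth function of these. -/
theorem exists_local_factorization {Ω : Set V} (hΩ : IsOpen Ω) {I : ι → V → ℝ}
    (hI : ∀ a, ContDiffOn ℝ ∞ (I a) Ω)
    (hind : ∀ ξ ∈ Ω, LinearIndependent ℝ (fun a => fderiv ℝ (I a) ξ)) {ξ : V} (hξ : ξ ∈ Ω)
    {U : Set V} (hU : IsOpen U) (hξU : ξ ∈ U) :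
    ∃ N : Set V, IsOpen N ∧ ξ ∈ N ∧ N ⊆ U ∩ Ω ∧
      ∀ f : V → ℝ, ContDiffOn ℝ ∞ f N →
        (∀ η ∈ N, ∀ v, (∀ a, fderiv ℝ (I a) η v = 0) → fderiv ℝ f η v = 0) →
        ∃ (W : Set (ι → ℝ)) (F : (ι → ℝ) → ℝ),
          IsOpen W ∧ (∀ η ∈ N, (fun a => I a η) ∈ W) ∧ ContDiffOn ℝ ∞ F W ∧
          ∀ η ∈ N, f η = F (fun a => I a η) := by
  classical
  have hIat : ∀ η ∈ Ω, ∀ a, ContDiffAt ℝ ∞ (I a) η := fun η hη a =>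
    (hI a).contDiffAt (hΩ.mem_nhds hη)
  let dJ : V → (V →L[ℝ] (ι → ℝ)) := fun η => ContinuousLinearMap.pi fun a => fderiv ℝ (I a) η
  let L := dJ ξ
  have hLsurj : Function.Surjective L := by
    have h' : LinearIndependent ℝ (fun a => (fderiv ℝ (I a) ξ : V →ₗ[ℝ] ℝ)) :=
      (hind ξ hξ).map' (ContinuousLinearMap.coeLM ℝ)
        (LinearMap.ker_eq_bot.2 ContinuousLinearMap.coe_injective)
    exact surjective_of_linearIndependent_functionals h'
  obtain ⟨P₀, hP₀⟩ := LinearMap.exists_leftInverse_of_injective (LinearMap.ker L.toLinearMap).subtype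
    (Submodule.ker_subtype _)
  have hP₀' : ∀ x : LinearMap.ker L.toLinearMap, P₀ x = x := fun x =>
    congrArg (fun T : LinearMap.ker L.toLinearMap →ₗ[ℝ] LinearMap.ker L.toLinearMap => T x) hP₀
  let P : V →L[ℝ] LinearMap.ker L.toLinearMap := LinearMap.toContinuousLinearMap P₀
  have hcompl : IsCompl (LinearMap.ker L.toLinearMap) (LinearMap.ker P₀) :=
    LinearMap.isCompl_of_proj hP₀'
  have hPsurj : LinearMap.range P₀ = ⊤ :=
    LinearMap.range_eq_top.2 fun x => ⟨x, hP₀' x⟩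
  let T : V ≃L[ℝ] (ι → ℝ) × LinearMap.ker L.toLinearMap :=
    ContinuousLinearMap.equivProdOfSurjectiveOfIsCompl L P (LinearMap.range_eq_top.2 hLsurj)
      hPsurj hcompl
  -- The family `I` is completed to a chart at `ξ` by a linear projection onto the kernel of its
  -- differential there.
  let Φ : V → (ι → ℝ) × LinearMap.ker L.toLinearMap := fun η => (fun a => I a η, P η)
  have hΦd : ∀ η ∈ Ω, HasFDerivAt Φ ((dJ η).prod P) η := fun η hη =>
    (hasFDerivAt_pi.2 fun a => ((hIat η hη a).differentiableAt (by simp)).hasFDerivAt).prodMk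
      P.hasFDerivAt
  have hΦs : ContDiffOn ℝ ∞ Φ Ω := (contDiffOn_pi.2 hI).prodMk P.contDiff.contDiffOn
  have hΦat : ∀ η ∈ Ω, ContDiffAt ℝ ∞ Φ η := fun η hη => hΦs.contDiffAt (hΩ.mem_nhds hη)
  have hT : HasFDerivAt Φ (T : V →L[ℝ] (ι → ℝ) × LinearMap.ker L.toLinearMap) ξ := hΦd ξ hξ
  let e := (hΦat ξ hξ).toOpenPartialHomeomorph Φ hT (by simp)
  have he : ∀ η, e η = Φ η := fun _ => rfl
  have hξe : ξ ∈ e.source := (hΦat ξ hξ).mem_toOpenPartialHomeomorph_source hT (by simp)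
  -- The differential of `Φ` must be invertible at every point used, not only at `ξ`, for the
  -- inverse to be smooth on a whole ball.
  let Ω' := Ω ∩ fderiv ℝ Φ ⁻¹' range
    ((↑) : (V ≃L[ℝ] (ι → ℝ) × LinearMap.ker L.toLinearMap) → V →L[ℝ] _)
  have hΩ' : IsOpen Ω' := (hΦs.continuousOn_fderiv_of_isOpen hΩ (by simp)).isOpen_inter_preimage
    hΩ (ContinuousLinearEquiv.isOpen)
  let S := e.source ∩ (U ∩ Ω')
  have hS : IsOpen S := e.open_source.inter (hU.inter hΩ')
  have hξS : ξ ∈ S := ⟨hξe, hξU, hξ, T, hT.fderiv.symm⟩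
  have hSe : S ⊆ e.source := inter_subset_left
  have himg : IsOpen (e '' S) := e.isOpen_image_of_subset_source hS hSe
  obtain ⟨ε, hε, hball⟩ := Metric.isOpen_iff.1 himg (Φ ξ) ⟨ξ, hξS, rfl⟩
  have hback : ∀ z ∈ Metric.ball (Φ ξ) ε, z ∈ e.target ∧ e.symm z ∈ S := by
    intro z hz
    obtain ⟨s, hs, rfl⟩ := hball hz
    exact ⟨e.map_source (hSe hs), by rwa [e.left_inv (hSe hs)]⟩
  let N := S ∩ (e.source ∩ e ⁻¹' Metric.ball (Φ ξ) ε)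
  have hN : IsOpen N := hS.inter (e.isOpen_inter_preimage Metric.isOpen_ball)
  have hbackN : ∀ z ∈ Metric.ball (Φ ξ) ε, e.symm z ∈ N := by
    intro z hz
    obtain ⟨h1, h2⟩ := hback z hz
    refine ⟨h2, hSe h2, ?_⟩
    rw [mem_preimage, e.right_inv h1]
    exact hz
  have hsymm : ∀ z ∈ Metric.ball (Φ ξ) ε, ∃ Tz : V ≃L[ℝ] (ι → ℝ) × LinearMap.ker L.toLinearMap,
      HasFDerivAt Φ (Tz : V →L[ℝ] _) (e.symm z) ∧
      HasFDerivAt e.symm (Tz.symm : _ →L[ℝ] V) z ∧ ContDiffAt ℝ ∞ e.symm z := by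
    intro z hz
    obtain ⟨h1, h2⟩ := hback z hz
    obtain ⟨Tz, hTz⟩ := h2.2.2.2
    have h3 : HasFDerivAt Φ (Tz : V →L[ℝ] _) (e.symm z) := by
      rw [hTz]
      exact ((hΦat _ h2.2.2.1).differentiableAt (by simp)).hasFDerivAt
    exact ⟨Tz, h3, e.hasFDerivAt_symm h1 h3, e.contDiffAt_symm h1 h3 (hΦat _ h2.2.2.1)⟩
  refine ⟨N, hN, ⟨hξS, hξe, Metric.mem_ball_self hε⟩, fun η hη => ⟨hη.1.2.1, hη.1.2.2.1⟩, ?_⟩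
  intro f hf hker
  have hfat : ∀ η ∈ N, ContDiffAt ℝ ∞ f η := fun η hη => hf.contDiffAt (hN.mem_nhds hη)
  refine ⟨Metric.ball (Φ ξ).1 ε, fun y => f (e.symm (y, (Φ ξ).2)), Metric.isOpen_ball,
    fun η hη => ?_, fun y hy => ?_, fun η hη => ?_⟩
  · have h1 : e η ∈ Metric.ball (Φ ξ) ε := hη.2.2
    rw [← Prod.mk.eta (p := Φ ξ), ← ball_prod_same] at h1
    exact h1.1
  · have h1 : (y, (Φ ξ).2) ∈ Metric.ball (Φ ξ) ε := by
      rw [← Prod.mk.eta (p := Φ ξ), ← ball_prod_same]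
      exact ⟨hy, Metric.mem_ball_self hε⟩
    obtain ⟨_, _, _, h2⟩ := hsymm _ h1
    exact ((hfat _ (hbackN _ h1)).comp y (h2.comp y
      (contDiffAt_id.prodMk contDiffAt_const))).contDiffWithinAt
  · have h1 : e η ∈ Metric.ball (Φ ξ) ε := hη.2.2
    have h1' := h1
    rw [← Prod.mk.eta (p := Φ ξ), ← ball_prod_same] at h1'
    let y : ι → ℝ := fun a => I a η
    have hmem : ∀ z ∈ Metric.ball (Φ ξ).2 ε, (y, z) ∈ Metric.ball (Φ ξ) ε := by
      intro z hz
      rw [← Prod.mk.eta (p := Φ ξ), ← ball_prod_same]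
      exact ⟨h1'.1, hz⟩
    -- A ball in the product is a product of balls, so the slices with fixed `y` are convex. In the
    -- chart `f` has zero derivative along them, so it equals its value on the central slice.
    have hg : ∀ z ∈ Metric.ball (Φ ξ).2 ε,
        HasFDerivAt (fun z => f (e.symm (y, z))) (0 : _ →L[ℝ] ℝ) z := by
      intro z hz
      obtain ⟨Tz, h2, h3, _⟩ := hsymm _ (hmem z hz)
      have hNz := hbackN _ (hmem z hz)
      have h4 := ((hfat _ hNz).differentiableAt (by simp)).hasFDerivAt.comp z
        (h3.comp z ((hasFDerivAt_const y z).prodMk (hasFDerivAt_id z)))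
      refine h4.congr_fderiv (ContinuousLinearMap.ext fun w => ?_)
      refine hker _ hNz _ fun a => ?_
      have h5 := h2.unique (hΦd _ hNz.1.2.2.1)
      have h6 : ((dJ (e.symm (y, z))).prod P) (Tz.symm (0, w)) = (0, w) := by
        rw [← h5]
        exact Tz.apply_symm_apply _
      exact congrFun (congrArg Prod.fst h6) a
    have hconst := Metric.isOpen_ball.is_const_of_fderiv_eq_zero
      (convex_ball (Φ ξ).2 ε).isPreconnected
      (fun z hz => (hg z hz).differentiableAt.differentiableWithinAt) (fun z hz => (hg z hz).fderiv)
      h1'.2 (Metric.mem_ball_self hε)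
    have h7 : e.symm (y, (e η).2) = η := e.left_inv (hSe hη.1)
    rw [h7] at hconst
    exact hconst

end Factorization

/-! ### The Frenet equations -/

section FrenetEquations

open InnerProductSpace

variable {F : Type*} [NormedAddCommGroup F] [InnerProductSpace ℝ F]
  (B : OrthonormalBasis (Fin m) ℝ F)

/-- Applied with orthonormality it yields the skewness of the connection coefficients; applied with
triangularity it yields their tridiagonal shape. -/
theorem inner_deriv_add_inner_deriv {u v : ℝ → F} {u' v' : F} {t c : ℝ} (hu : HasDerivAt u u' t)
    (hv : HasDerivAt v v' t) (h : ∀ᶠ s in nhds t, inner ℝ (u s) (v s) = c) :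
    inner ℝ u' (v t) + inner ℝ (u t) v' = 0 := by
  have h1 := (hu.inner ℝ hv).congr_of_eventuallyEq (f₁ := fun _ => c)
    (h.mono fun s hs => hs.symm)
  rw [add_comm]
  exact h1.unique (hasDerivAt_const _ _)

/-- The velocities of an orthonormal frame with tridiagonal structure. -/
theorem sum_tridiagonal (B : OrthonormalBasis (Fin m) ℝ F) {X D : ℕ → F} (hX : Orthonormal ℝ (fun i : Fin m => X i)) {c : ℕ → ℝ}
    (hanti : ∀ i j, i < m → j < m → inner ℝ (D i) (X j) = - inner ℝ (X i) (D j))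
    (hfar : ∀ i, i < m → ∀ n, n + 1 < i → inner ℝ (D i) (X n) = 0)
    (hnear : ∀ n, n + 1 < m → inner ℝ (D (n + 1)) (X n) = - c (n + 1)) {i : ℕ} (hi : i < m) :
    (if i = 0 then 0 else -(c i • X (i - 1))) + (if i + 1 < m then c (i + 1) • X (i + 1) else 0)
      = D i := by
  have hcoef : ∀ j < m, inner ℝ (X j) (D i) • X j =
      (if j = i - 1 then (if i = 0 then 0 else -(c i • X (i - 1))) else 0)
      + (if j = i + 1 then c (i + 1) • X (i + 1) else 0) := by
    intro j hj
    rcases Nat.lt_trichotomy j i with hji | rfl | hij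
    · have h3 : j ≠ i + 1 := by omega
      have h4 : i ≠ 0 := by omega
      rw [if_neg h3, add_zero, real_inner_comm]
      by_cases h5 : j = i - 1
      · obtain rfl : i = j + 1 := by omega
        rw [hnear j hi, if_pos h5, if_neg h4, ← h5, neg_smul]
      · rw [if_neg h5, hfar i hi j (by omega), zero_smul]
    · have h3 : j ≠ j + 1 := by omega
      have h4 := hanti j j hj hj
      rw [real_inner_comm] at h4
      have h5 : inner ℝ (X j) (D j) = 0 := by linarith
      rw [h5, zero_smul, if_neg h3, add_zero]
      by_cases h6 : j = 0
      · simp [h6]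
      · rw [if_neg (by omega)]
    · have h3 : j ≠ i - 1 := by omega
      have h4 := hanti j i hj hi
      rw [if_neg h3, zero_add]
      have h5 : inner ℝ (X j) (D i) = - inner ℝ (D j) (X i) := by linarith
      rw [h5]
      by_cases h6 : j = i + 1
      · subst h6
        rw [hnear i hj, if_pos rfl, neg_neg]
      · rw [hfar j hj i (by omega), if_neg h6, neg_zero, zero_smul]
  have hsum := sum_inner_smul_eq B hX (D i)
  rw [Finset.sum_congr rfl fun j hj => hcoef j (Finset.mem_range.1 hj), Finset.sum_add_distrib,
    Finset.sum_ite_eq', Finset.sum_ite_eq', if_pos (Finset.mem_range.2 (by omega))] at hsum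
  simpa only [Finset.mem_range] using hsum

/-- The velocities of an orthonormal frame in which a curve of derivatives is triangular. -/
theorem velocity_of_triangular (B : OrthonormalBasis (Fin m) ℝ F) {X x : ℕ → ℝ → F} {D : ℕ → F}
    {ρ : ℕ → ℝ} {t : ℝ}
    (hon : ∀ᶠ s in nhds t, Orthonormal ℝ (fun i : Fin m => X i s))
    (hX : ∀ i < m, HasDerivAt (X i) (D i) t)
    (hx : ∀ j, j + 1 < m → HasDerivAt (x j) (x (j + 1) t) t)
    (htri : ∀ i j, j < i → i < m → ∀ s, inner ℝ (X i s) (x j s) = 0)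
    (hdiag : ∀ n, inner ℝ (X n t) (x n t) = ρ n) (hρ : ∀ n, n + 1 < m → 0 < ρ n)
    (hsum : ∀ n, n + 1 < m → x n t = ρ n • X n t
      + ∑ j ∈ Finset.range n, inner ℝ (X j t) (x n t) • X j t) {i : ℕ} (hi : i < m) :
    (if i = 0 then 0 else -((ρ i / ρ (i - 1)) • X (i - 1) t))
      + (if i + 1 < m then (ρ (i + 1) / ρ i) • X (i + 1) t else 0) = D i := by
  have hanti : ∀ i j, i < m → j < m → inner ℝ (D i) (X j t) = - inner ℝ (X i t) (D j) := by
    intro i j hi hj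
    refine eq_neg_of_add_eq_zero_left (inner_deriv_add_inner_deriv (c := if i = j then 1 else 0)
      (hX i hi) (hX j hj) (hon.mono fun s hs => ?_))
    have := orthonormal_iff_ite.1 hs ⟨i, hi⟩ ⟨j, hj⟩
    simpa only [Fin.mk.injEq] using this
  have hDx : ∀ i n, n < i → i < m → inner ℝ (D i) (x n t) = - inner ℝ (X i t) (x (n + 1) t) :=
    fun i n hn hi => eq_neg_of_add_eq_zero_left (inner_deriv_add_inner_deriv (hX i hi)
      (hx n (by omega)) (Filter.Eventually.of_forall fun s => htri i n hn hi s))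
  -- For `n + 1 < i` the velocity `D i` is orthogonal to `x n`. Expanding `x n` in the frame and
  -- using the induction hypothesis leaves `ρ n` times the wanted product, and `ρ n` is positive.
  have hfar : ∀ i, i < m → ∀ n, n + 1 < i → inner ℝ (D i) (X n t) = 0 := by
    intro i hi n
    induction n using Nat.strong_induction_on with
    | _ n ih =>
      intro hn
      have h1 := hDx i n (by omega) hi
      rw [htri i (n + 1) hn hi, hsum n (by omega), inner_add_right, inner_sum,
        Finset.sum_eq_zero, add_zero, real_inner_smul_right, neg_zero] at h1
      · exact (mul_eq_zero.1 h1).resolve_left (hρ n (by omega)).ne'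
      · intro j hj
        have hj := Finset.mem_range.1 hj
        rw [real_inner_smul_right, ih j hj (by omega), mul_zero]
  have hnear : ∀ n, n + 1 < m → inner ℝ (D (n + 1)) (X n t) = - (ρ (n + 1) / ρ (n + 1 - 1)) := by
    intro n hn
    have h1 := hDx (n + 1) n (by omega) hn
    rw [hsum n hn, inner_add_right, inner_sum, Finset.sum_eq_zero, add_zero,
      real_inner_smul_right, hdiag] at h1
    · have := (hρ n hn).ne'
      rw [Nat.add_sub_cancel, ← neg_div, eq_div_iff this, mul_comm]
      exact h1
    · intro j hj
      have hj := Finset.mem_range.1 hj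
      rw [real_inner_smul_right, hfar (n + 1) hn j (by omega), mul_zero]
  exact sum_tridiagonal B (X := fun i => X i t) (c := fun n => ρ n / ρ (n - 1)) hon.self_of_nhds
    hanti hfar hnear hi

/-- The Frenet equations for the frame of a curve in general position. -/
theorem frenet_equations {x : ℕ → ℝ → F} {U : Set ℝ} (hU : IsOpen U)
    (hx : ∀ j < m, ∀ t ∈ U, ContDiffAt ℝ ∞ (x j) t)
    (hx' : ∀ j, j + 1 < m → ∀ t ∈ U, HasDerivAt (x j) (x (j + 1) t) t)
    (hind : ∀ t ∈ U, LinearIndependent ℝ (fun i : Fin (m - 1) => x i t))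
    {t : ℝ} (ht : t ∈ U) {i : ℕ} (hi : i < m) (hm : 2 ≤ m) :
    (kap B (fun j => x j t) 0)⁻¹ • deriv (fun s => frame B (fun j => x j s) i) t =
      (if i = 0 then 0 else -(kap B (fun j => x j t) i • frame B (fun j => x j t) (i - 1))) +
      (if i + 1 < m then kap B (fun j => x j t) (i + 1) • frame B (fun j => x j t) (i + 1)
        else 0) := by
  have hX : ∀ i < m, HasDerivAt (fun s => frame B (fun j => x j s) i)
      (deriv (fun s => frame B (fun j => x j s) i) t) t := by
    intro i hi
    have h1 : LinearIndependent ℝ (fun k : Fin (min (i + 1) (m - 1)) => x k t) :=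
      linearIndependent_fin_mono (x := fun j => x j t) (hind t ht) (min_le_right _ _)
    have h2 : ContDiffAt ℝ ∞ (fun s => frame B (fun j => x j s) i) t :=
      contDiffAt_frame B (x := fun s j => x j s)
        (fun j hj => hx j (lt_of_le_of_lt hj hi) t ht) hi h1
    exact (h2.differentiableAt (by simp)).hasDerivAt
  have hρ : ∀ n, n + 1 < m → 0 < rho B (fun j => x j t) n := fun n hn =>
    rho_pos B (hind t ht) (by omega) hn
  have hxsum : ∀ n, n + 1 < m → x n t = rho B (fun j => x j t) n • frame B (fun j => x j t) n
      + ∑ j ∈ Finset.range n, inner ℝ (frame B (fun j => x j t) j) (x n t) •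
        frame B (fun j => x j t) j := by
    intro n hn
    have h1 := sub_sum_gramSchmidtNormed (fun j => x j t) n
    rw [← frame_of_lt B _ hn, ← rho_of_lt B _ hn] at h1
    refine h1.trans (congrArg _ (Finset.sum_congr rfl fun j hj => ?_))
    have hj := Finset.mem_range.1 hj
    rw [← frame_of_lt B _ (show j + 1 < m by omega)]
  -- Passing from `d/dt` to the derivative along `X_1` turns the ratio of consecutive leading
  -- coefficients into the curvature.
  have hκ : ∀ n, n ≠ 0 → (kap B (fun j => x j t) 0)⁻¹ *
      (rho B (fun j => x j t) n / rho B (fun j => x j t) (n - 1)) = kap B (fun j => x j t) n := by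
    intro n hn
    simp only [kap, hn, if_true, if_false]
    rw [inv_mul_eq_div, div_div]
  have h := velocity_of_triangular B (X := fun i s => frame B (fun j => x j s) i)
    (ρ := rho B (fun j => x j t)) (Filter.eventually_of_mem (hU.mem_nhds ht) fun s hs => orthonormal_frame B (hind s hs)) hX
    (fun j hj => hx' j hj t ht)
    (fun i j hj hi s => inner_frame_of_lt B (fun j => x j s) hj hi) (fun n => rfl) hρ hxsum hi
  rw [← h, smul_add]
  congr 1
  · split_ifs with h0
    · rw [smul_zero]
    · rw [smul_neg, smul_smul, hκ i h0]
  · split_ifs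
    · rw [smul_smul, ← hκ (i + 1) (Nat.succ_ne_zero i), Nat.add_sub_cancel]
    · rw [smul_zero]

end FrenetEquations

/-! ### Curvatures of Frenet curves: existence and uniqueness -/

/-- The standard orthonormal basis. -/
abbrev stdB (m : ℕ) : OrthonormalBasis (Fin m) ℝ (E m) := EuclideanSpace.basisFun (Fin m) ℝ

theorem vol_stdB (v : ℕ → E m) :
    vol (stdB m) v = (Matrix.of fun i j : Fin m => v j i).det := by
  rw [vol, Module.Basis.det_apply]
  rfl

theorem contDiffAt_iteratedDeriv {F : Type*} [NormedAddCommGroup F] [NormedSpace ℝ F]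
    {σ : ℝ → F} {t : ℝ} (h : ContDiffAt ℝ ∞ σ t) (j : ℕ) :
    ContDiffAt ℝ ∞ (iteratedDeriv j σ) t := by
  induction j with
  | zero => simpa using h
  | succ j ih =>
    rw [iteratedDeriv_succ]
    have h1 : ContDiffAt ℝ ∞ (fderiv ℝ (iteratedDeriv j σ)) t :=
      ih.fderiv_right (m := ∞) (by simp)
    exact h1.clm_apply contDiffAt_const

theorem hasDerivAt_iteratedDeriv {F : Type*} [NormedAddCommGroup F] [NormedSpace ℝ F]
    {σ : ℝ → F} {t : ℝ} (h : ContDiffAt ℝ ∞ σ t) (j : ℕ) :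
    HasDerivAt (iteratedDeriv j σ) (iteratedDeriv (j + 1) σ t) t := by
  rw [iteratedDeriv_succ]
  exact ((contDiffAt_iteratedDeriv h j).differentiableAt (by simp)).hasDerivAt

section Curves

open InnerProductSpace

theorem inner_eq_zero_of_mem_span {F : Type*} [NormedAddCommGroup F] [InnerProductSpace ℝ F]
    {ι : Type*} {v : ι → F} {u w : F} (h : ∀ i, inner ℝ u (v i) = 0)
    (hw : w ∈ Submodule.span ℝ (range v)) : inner ℝ u w = 0 := by
  induction hw using Submodule.span_induction with
  | mem x hx => obtain ⟨i, rfl⟩ := hx; exact h i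
  | zero => exact inner_zero_right _
  | add x y _ _ hx hy => rw [inner_add_right, hx, hy, add_zero]
  | smul c x _ hx => rw [real_inner_smul_right, hx, mul_zero]

/-- The curvatures of a Frenet curve are given by the universal functions of its derivatives. -/
theorem curvature_eq_kap (hm : 2 ≤ m) {σ : ℝ → E m} {a b : ℝ} {X : ℕ → ℝ → E m} {κ : ℕ → ℝ → ℝ}
    (hσ : IsFrenetCurve σ a b) (hF : IsFrenetFrame σ a b X κ) {t : ℝ} (ht : t ∈ Ioo a b) {i : ℕ}
    (hi : i < m) : κ i t = kap (stdB m) (fun j => iteratedDeriv (j + 1) σ t) i := by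
  have hσt : ∀ s ∈ Ioo a b, ContDiffAt ℝ ∞ σ s := fun s hs =>
    hσ.1.contDiffAt (isOpen_Ioo.mem_nhds hs)
  have hon : ∀ s ∈ Ioo a b, ∀ i j, i < m → j < m →
      inner ℝ (X (i + 1) s) (X (j + 1) s) = if i = j then (1 : ℝ) else 0 := by
    intro s hs i j hi hj
    have := orthonormal_iff_ite.1 (hF.orthonormal s hs) ⟨i, hi⟩ ⟨j, hj⟩
    simpa only [Fin.mk.injEq] using this
  have htri : ∀ s ∈ Ioo a b, ∀ i j, j < i → i < m → j + 1 < m →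
      inner ℝ (X (i + 1) s) (iteratedDeriv (j + 1) σ s) = 0 := by
    intro s hs i j hji hi hj
    have h1 : iteratedDeriv (j + 1) σ s ∈
        Submodule.span ℝ (range fun k : Fin (j + 1) => iteratedDeriv ((k : ℕ) + 1) σ s) :=
      Submodule.subset_span ⟨⟨j, Nat.lt_succ_self j⟩, rfl⟩
    rw [← hF.same_span (j + 1) (by omega) (by omega) s hs] at h1
    refine inner_eq_zero_of_mem_span (fun k => ?_) h1
    have hk := k.isLt
    rw [hon s hs i k hi (by omega), if_neg (by omega)]
  have hX : ∀ i, 1 ≤ i → i ≤ m → HasDerivAt (X i) (deriv (X i) t) t := fun i h1 h2 =>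
    (((hF.smooth_frame i h1 h2).contDiffAt (isOpen_Ioo.mem_nhds ht)).differentiableAt
      (by simp)).hasDerivAt
  have hκpos : ∀ j, j + 1 < m → 0 < κ j t := fun j hj => hF.curvature_pos j (by omega) t ht
  have hr0 : inner ℝ (X 1 t) (iteratedDeriv 1 σ t) = κ 0 t := by
    have h1 := hon t ht 0 0 (by omega) (by omega)
    rw [iteratedDeriv_one, hF.tangent t ht, real_inner_smul_right]
    rw [zero_add, if_pos rfl] at h1
    rw [h1, mul_one]
  have hκ0 := (hκpos 0 (by omega)).ne'
  -- Differentiating `⟨X_{n+2}, σ^{(n+1)}⟩ = 0` and inserting the Frenet equation leaves only the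
  -- term in `X_{n+1}`. With positive curvatures this recursion gives the positive diagonal required
  -- by `eq_frame`, and it later yields the curvatures.
  have hr : ∀ n, n + 1 < m → inner ℝ (X (n + 2) t) (iteratedDeriv (n + 2) σ t)
      = κ 0 t * κ (n + 1) t * inner ℝ (X (n + 1) t) (iteratedDeriv (n + 1) σ t) := by
    intro n hn
    have h1 := inner_deriv_add_inner_deriv (c := 0) (hX (n + 2) (by omega) (by omega))
      (hasDerivAt_iteratedDeriv (hσt t ht) (n + 1))
      (Filter.eventually_of_mem (isOpen_Ioo.mem_nhds ht) fun s hs =>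
        htri s hs (n + 1) n (by omega) hn hn)
    have h2 : inner ℝ ((κ 0 t)⁻¹ • deriv (X (n + 2)) t) (iteratedDeriv (n + 1) σ t)
        = - (κ (n + 1) t * inner ℝ (X (n + 1) t) (iteratedDeriv (n + 1) σ t)) := by
      by_cases hlast : n + 2 < m
      · rw [hF.frenet_middle (n + 2) (by omega) (by omega) t ht, inner_add_left, inner_neg_left,
          real_inner_smul_left, real_inner_smul_left, htri t ht (n + 2) n (by omega) hlast hn,
          mul_zero, add_zero]
        rfl
      · obtain rfl : m = n + 2 := by omega
        rw [hF.frenet_last t ht, inner_neg_left, real_inner_smul_left]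
        rfl
    rw [real_inner_smul_left, inv_mul_eq_iff_eq_mul₀ hκ0] at h2
    linarith
  have hpos : ∀ n, n + 1 < m → 0 < inner ℝ (X (n + 1) t) (iteratedDeriv (n + 1) σ t) := by
    intro n
    induction n with
    | zero => intro h; rw [zero_add, hr0]; exact hκpos 0 h
    | succ n ih =>
      intro hn
      rw [hr n (by omega)]
      exact mul_pos (mul_pos (hκpos 0 (by omega)) (hκpos _ hn)) (ih (by omega))
  have hframe : ∀ n, n < m → X (n + 1) t
      = frame (stdB m) (fun j => iteratedDeriv (j + 1) σ t) n := fun n hn =>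
    eq_frame (stdB m) (X := fun n => X (n + 1) t) (hF.orthonormal t ht)
      (by rw [vol_stdB]; exact hF.positively_oriented t ht)
      (fun i j hji hi hj => htri t ht i j hji hi hj) hpos hn
  have hrho : ∀ n, n < m → rho (stdB m) (fun j => iteratedDeriv (j + 1) σ t) n
      = inner ℝ (X (n + 1) t) (iteratedDeriv (n + 1) σ t) := fun n hn => by
    rw [rho, ← hframe n hn]
  rcases i with _ | n
  · simp only [kap, if_true]
    rw [hrho 0 hi, zero_add, hr0]
  · simp only [kap, Nat.succ_ne_zero, if_false, Nat.add_sub_cancel]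
    rw [hrho _ hi, hrho n (by omega), hrho 0 (by omega), zero_add, hr0, hr n hi]
    have := (hpos n (by omega)).ne'
    field_simp

/-- Curves in general position have a Frenet frame. -/
theorem exists_isFrenetFrame (hm : 2 ≤ m) {σ : ℝ → E m} {a b : ℝ} (hσ : IsFrenetCurve σ a b) :
    IsFrenetFrame σ a b
      (fun i t => frame (stdB m) (fun j => iteratedDeriv (j + 1) σ t) (i - 1))
      (fun i t => kap (stdB m) (fun j => iteratedDeriv (j + 1) σ t) i) := by
  have hσt : ∀ s ∈ Ioo a b, ContDiffAt ℝ ∞ σ s := fun s hs =>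
    hσ.1.contDiffAt (isOpen_Ioo.mem_nhds hs)
  have hx : ∀ j, ∀ t ∈ Ioo a b, ContDiffAt ℝ ∞ (fun t => iteratedDeriv (j + 1) σ t) t :=
    fun j t ht => contDiffAt_iteratedDeriv (hσt t ht) _
  have hind : ∀ t ∈ Ioo a b,
      LinearIndependent ℝ (fun i : Fin (m - 1) => iteratedDeriv ((i : ℕ) + 1) σ t) := hσ.2
  have hind' : ∀ t ∈ Ioo a b, ∀ d, d ≤ m - 1 →
      LinearIndependent ℝ (fun i : Fin d => iteratedDeriv ((i : ℕ) + 1) σ t) :=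
    fun t ht d hd => linearIndependent_fin_mono (x := fun j => iteratedDeriv (j + 1) σ t)
      (hind t ht) hd
  have hfr : ∀ t ∈ Ioo a b, ∀ i < m, _ := fun t ht i hi =>
    frenet_equations (stdB m) (x := fun j t => iteratedDeriv (j + 1) σ t) isOpen_Ioo
      (fun j _ => hx j) (fun j _ t ht => hasDerivAt_iteratedDeriv (hσt t ht) _) hind ht hi hm
  have hrho : ∀ t ∈ Ioo a b, ∀ n, n + 1 < m →
      0 < rho (stdB m) (fun j => iteratedDeriv (j + 1) σ t) n := fun t ht n hn =>
    rho_pos (stdB m) (x := fun j => iteratedDeriv (j + 1) σ t) (hind t ht) (by omega) hn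
  refine
    { smooth_frame := fun i h1 hi t ht => ?_
      smooth_curvature := fun i hi t ht => ?_
      curvature_pos := fun j hj t ht => ?_
      orthonormal := fun t ht => ?_
      positively_oriented := fun t ht => ?_
      same_span := fun n hn hnm t ht => ?_
      same_orientation := fun n hn hnm t ht => ?_
      tangent := fun t ht => ?_
      frenet_first := fun t ht => ?_
      frenet_middle := fun i hi1 hi2 t ht => ?_
      frenet_last := fun t ht => ?_ }
  · exact (contDiffAt_frame (stdB m) (x := fun t j => iteratedDeriv (j + 1) σ t)
      (fun j _ => hx j t ht) (by omega) (hind' t ht _ (min_le_right _ _))).contDiffWithinAt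
  · exact (contDiffAt_kap (stdB m) (x := fun t j => iteratedDeriv (j + 1) σ t)
      (fun j _ => hx j t ht) (by omega) (hind' t ht _ (min_le_right _ _))).contDiffWithinAt
  · unfold kap
    split_ifs with h0
    · exact hrho t ht 0 (by omega)
    · exact div_pos (hrho t ht j (by omega))
        (mul_pos (hrho t ht (j - 1) (by omega)) (hrho t ht 0 (by omega)))
  · exact orthonormal_frame (stdB m) (x := fun j => iteratedDeriv (j + 1) σ t) (hind t ht)
  · have := vol_frame (stdB m) (by omega) (x := fun j => iteratedDeriv (j + 1) σ t) (hind t ht)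
    rw [vol_stdB] at this
    simp only [Nat.add_sub_cancel]
    rw [this]
    exact one_pos
  · have himg : ∀ v : ℕ → E m, (range fun j : Fin n => v j) = v '' Set.Iio n := by
      intro v
      ext w
      constructor
      · rintro ⟨j, rfl⟩; exact ⟨j, j.isLt, rfl⟩
      · rintro ⟨j, hj, rfl⟩; exact ⟨⟨j, hj⟩, rfl⟩
    have h1 : (fun j : Fin n => frame (stdB m) (fun j => iteratedDeriv (j + 1) σ t) ((j : ℕ) + 1 - 1))
        = fun j : Fin n => gramSchmidtNormed ℝ (fun j => iteratedDeriv (j + 1) σ t) j := by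
      funext j
      have := j.isLt
      rw [Nat.add_sub_cancel, frame_of_lt _ _ (by omega)]
    rw [h1, himg (gramSchmidtNormed ℝ fun j => iteratedDeriv (j + 1) σ t),
      himg fun j => iteratedDeriv (j + 1) σ t, span_gramSchmidtNormed, span_gramSchmidt_Iio]
  · rw [Matrix.det_of_isUpperTriangular]
    · refine Finset.prod_pos fun i _ => ?_
      have := i.isLt
      exact hrho t ht i (by omega)
    · intro i j hij
      have h1 : (j : ℕ) < i := hij
      have := i.isLt
      exact inner_frame_of_lt (stdB m) (fun j => iteratedDeriv (j + 1) σ t) h1 (by omega)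
  · have h1 := sub_sum_gramSchmidtNormed (fun j => iteratedDeriv (j + 1) σ t) 0
    rw [Finset.sum_range_zero, add_zero, ← rho_of_lt (stdB m) _ (by omega),
      ← frame_of_lt (stdB m) _ (by omega)] at h1
    rw [← iteratedDeriv_one]
    exact h1
  · have := hfr t ht 0 (by omega)
    rw [if_pos rfl, zero_add, if_pos (by omega)] at this
    exact this
  · have := hfr t ht (i - 1) (by omega)
    rw [if_neg (by omega), if_pos (by omega)] at this
    have h2 : i - 1 + 1 = i := by omega
    rw [h2] at this
    exact this
  · have := hfr t ht (m - 1) (by omega)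
    rw [if_neg (by omega), if_neg (by omega), add_zero] at this
    exact this

/-- The curvature functions on jets. -/
theorem curvatureFun_eq_kap (hm : 2 ≤ m) {ξ : Jet m m} (hξ : DerivIndependent (m - 1) ξ) {i : ℕ}
    (hi : i < m) : curvatureFun m i ξ = kap (stdB m) (fun j => coord ξ (j + 1)) i := by
  -- The choice in `curvatureFun` is meaningful only if some Frenet curve has the jet `ξ`; the
  -- Taylor polynomial is one near `ξ.1`, because independence is an open condition.
  have hex : ∃ c, IsCurvatureAt i ξ c := by
    have hopen : IsOpen {s : ℝ | LinearIndependent ℝ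
        (fun k : Fin (m - 1) => iteratedDeriv ((k : ℕ) + 1) (taylorCurve ξ) s)} := by
      refine isOpen_setOfPred_linearIndependent.preimage
        (f := fun (s : ℝ) (k : Fin (m - 1)) => iteratedDeriv ((k : ℕ) + 1) (taylorCurve ξ) s)
        (continuous_pi fun k => ?_)
      exact continuous_iff_continuousAt.2 fun s =>
        (contDiffAt_iteratedDeriv (contDiff_taylorCurve ξ).contDiffAt _).continuousAt
    have hmem : ξ.1 ∈ {s : ℝ | LinearIndependent ℝ
        (fun k : Fin (m - 1) => iteratedDeriv ((k : ℕ) + 1) (taylorCurve ξ) s)} := by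
      simp only [mem_ofPred_eq, iteratedDeriv_taylorCurve_self]
      exact hξ
    obtain ⟨ε, hε, hball⟩ := Metric.isOpen_iff.1 hopen _ hmem
    rw [Real.ball_eq_Ioo] at hball
    have hcurve : IsFrenetCurve (taylorCurve ξ) (ξ.1 - ε) (ξ.1 + ε) :=
      ⟨(contDiff_taylorCurve ξ).contDiffOn, fun t ht => hball ht⟩
    exact ⟨_, taylorCurve ξ, ξ.1 - ε, ξ.1 + ε, _, _, ⟨by linarith, by linarith⟩, hcurve,
      exists_isFrenetFrame hm hcurve, jet_taylorCurve ξ, rfl⟩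
  obtain ⟨σ, a, b, X, κ, ht, hσ, hF, hjet, hκ⟩ := Classical.epsilon_spec hex
  rw [curvatureFun, ← hκ, curvature_eq_kap hm hσ hF ht hi]
  refine kap_congr (stdB m) hi fun j hj => ?_
  have := coord_jet (r := m) σ ξ.1 (show j + 1 ≤ m by omega)
  rw [hjet] at this
  exact this.symm

end Curves

/-! ### Total derivatives: smoothness, invariance, order and top coefficient -/

section TotalDerivative

variable {F : Type*} [NormedAddCommGroup F] [InnerProductSpace ℝ F] {l : ℕ}

/-- The projection of jets as a continuous linear map. -/
def projL (F : Type*) [NormedAddCommGroup F] [InnerProductSpace ℝ F] {l r : ℕ} (h : l ≤ r) :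
    (ℝ × (Fin (r + 1) → F)) →L[ℝ] (ℝ × (Fin (l + 1) → F)) :=
  (ContinuousLinearMap.fst ℝ ℝ (Fin (r + 1) → F)).prod
    (ContinuousLinearMap.pi fun k =>
      (ContinuousLinearMap.proj (φ := fun _ : Fin (r + 1) => F)
        (Fin.castLE (Nat.succ_le_succ h) k)).comp
      (ContinuousLinearMap.snd ℝ ℝ (Fin (r + 1) → F)))

/-- The map `(t, x_0, …, x_{r+1}) ↦ (0, x_1, …, x_{r+1})`. -/
def shiftL (F : Type*) [NormedAddCommGroup F] [InnerProductSpace ℝ F] (r : ℕ) :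
    (ℝ × (Fin (r + 1 + 1) → F)) →L[ℝ] (ℝ × (Fin (r + 1) → F)) :=
  (0 : (ℝ × (Fin (r + 1 + 1) → F)) →L[ℝ] ℝ).prod
    (ContinuousLinearMap.pi fun k =>
      (ContinuousLinearMap.proj (φ := fun _ : Fin (r + 1 + 1) => F) k.succ).comp
      (ContinuousLinearMap.snd ℝ ℝ (Fin (r + 1 + 1) → F)))

/-- The linear part of `affineAct`. -/
def linearAct (L : F →L[ℝ] F) (r : ℕ) :
    (ℝ × (Fin (r + 1) → F)) →L[ℝ] (ℝ × (Fin (r + 1) → F)) :=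
  (ContinuousLinearMap.fst ℝ ℝ (Fin (r + 1) → F)).prod
    (ContinuousLinearMap.pi fun k => L.comp
      ((ContinuousLinearMap.proj (φ := fun _ : Fin (r + 1) => F) k).comp
      (ContinuousLinearMap.snd ℝ ℝ (Fin (r + 1) → F))))

theorem shift_eq (ξ : ℝ × (Fin (r + 1 + 1) → F)) :
    ((1, fun k => ξ.2 (Fin.succ k)) : ℝ × (Fin (r + 1) → F)) = (1, 0) + shiftL F r ξ := by
  ext <;> simp [shiftL]

theorem hasFDerivAt_affineAct (L : F →L[ℝ] F) (c : F) (ξ : ℝ × (Fin (r + 1) → F)) :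
    HasFDerivAt (affineAct L c) (linearAct L r) ξ := by
  have h : affineAct L c = fun ξ : ℝ × (Fin (r + 1) → F) =>
      linearAct L r ξ + (0, fun k : Fin (r + 1) => if (k : ℕ) = 0 then c else 0) := by
    funext ξ
    ext <;> simp [linearAct, affineAct]
  rw [h]
  exact (linearAct L r).hasFDerivAt.add_const _

theorem linearAct_shift (L : F →L[ℝ] F) (c : F) (ξ : ℝ × (Fin (r + 1 + 1) → F)) :
    linearAct L r (1, fun k => ξ.2 (Fin.succ k)) =
      (1, fun k => (affineAct L c ξ).2 (Fin.succ k)) := by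
  ext <;> simp [linearAct, affineAct]

theorem projL_affineAct (h : l ≤ r) (L : F →L[ℝ] F) (c : F) (ξ : ℝ × (Fin (r + 1) → F)) :
    projL F h (affineAct L c ξ) = affineAct L c (projL F h ξ) := by
  ext k
  · simp [projL, affineAct]
  · simp only [projL, affineAct, ContinuousLinearMap.prod_apply, ContinuousLinearMap.coe_pi',
      ContinuousLinearMap.comp_apply, ContinuousLinearMap.proj_apply, ContinuousLinearMap.coe_snd',
      Fin.val_castLE]

theorem projL_single_last (v : F) :
    projL F (Nat.le_succ r) (0, Pi.single (Fin.last (r + 1)) v) = 0 := by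
  ext k
  · simp [projL]
  · have : Fin.castLE (Nat.succ_le_succ (Nat.le_succ r)) k ≠ Fin.last (r + 1) := by
      intro h
      have := congrArg Fin.val h
      have := k.isLt
      simp at *
      omega
    simp [projL, this]

theorem projL_single_of_lt (h : l ≤ r) {k : Fin (r + 1)} (hk : l < k) (v : F) :
    projL F h (0, Pi.single k v) = 0 := by
  ext j
  · simp [projL]
  · have : Fin.castLE (Nat.succ_le_succ h) j ≠ k := by
      intro e
      have := congrArg Fin.val e
      have := j.isLt
      simp at *
      omega
    simp [projL, this]

theorem projL_single (h : l ≤ r) (k : Fin (l + 1)) (v : F) :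
    projL F h (0, Pi.single (Fin.castLE (Nat.succ_le_succ h) k) v) = (0, Pi.single k v) := by
  ext j
  · simp [projL]
  · simp only [projL, Pi.single_apply, ContinuousLinearMap.prod_apply, ContinuousLinearMap.coe_pi',
      ContinuousLinearMap.comp_apply, ContinuousLinearMap.proj_apply, ContinuousLinearMap.coe_snd',
      Fin.castLE_inj]

theorem shiftL_single_last (v : F) :
    shiftL F r (0, Pi.single (Fin.last (r + 1)) v) = (0, Pi.single (Fin.last r) v) := by
  ext k
  · simp [shiftL]
  · simp only [shiftL, Pi.single_apply, ContinuousLinearMap.prod_apply, ContinuousLinearMap.coe_pi',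
      ContinuousLinearMap.comp_apply, ContinuousLinearMap.proj_apply, ContinuousLinearMap.coe_snd',
      ← Fin.succ_last, Fin.succ_inj]

theorem projL_add_smul_single_last (ξ : ℝ × (Fin (r + 1 + 1) → F)) (s : ℝ) (v : F) :
    projL F (Nat.le_succ r) (ξ + s • (0, Pi.single (Fin.last (r + 1)) v)) =
      projL F (Nat.le_succ r) ξ := by
  rw [map_add, map_smul, projL_single_last, smul_zero, add_zero]

theorem shiftL_add_smul_single_last (ξ : ℝ × (Fin (r + 1 + 1) → F)) (s : ℝ) (v : F) :
    shiftL F r (ξ + s • (0, Pi.single (Fin.last (r + 1)) v)) =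
      shiftL F r ξ + s • (0, Pi.single (Fin.last r) v) := by
  rw [map_add, map_smul, shiftL_single_last]

theorem derivIndependent_affineAct {d : ℕ} {L : F →L[ℝ] F} (hL : Function.Injective L) (c : F)
    {ξ : ℝ × (Fin (r + 1) → F)} (h : DerivIndependent d ξ) :
    DerivIndependent d (affineAct L c ξ) := by
  unfold DerivIndependent at *
  simp only [coord_affineAct_succ]
  exact h.map' L.toLinearMap (LinearMap.ker_eq_bot.2 hL)

theorem proj_eq_projL (h : l ≤ r) (ξ : Jet m r) : proj h ξ = projL (E m) h ξ := rfl

theorem derivIndependent_proj {d : ℕ} (hd : d ≤ l) (h : l ≤ r) {ξ : Jet m r} :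
    DerivIndependent d (proj h ξ) ↔ DerivIndependent d ξ := by
  unfold DerivIndependent
  have : (fun i : Fin d => coord (proj h ξ) (i + 1)) = fun i : Fin d => coord ξ (i + 1) := by
    funext i
    have := i.isLt
    exact coord_proj h ξ (by omega)
  rw [this]

theorem contDiffAt_totalDeriv {f : Jet m r → ℝ} {ξ : Jet m (r + 1)}
    (hf : ContDiffAt ℝ ∞ f (proj (Nat.le_succ r) ξ)) : ContDiffAt ℝ ∞ (totalDeriv f) ξ := by
  have h1 : ContDiffAt ℝ ∞ (fderiv ℝ f) (projL (E m) (Nat.le_succ r) ξ) :=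
    hf.fderiv_right (by simp)
  have h2 : ContDiffAt ℝ ∞ (fun η : Jet m (r + 1) => fderiv ℝ f (projL (E m) (Nat.le_succ r) η)) ξ :=
    h1.comp ξ (projL (E m) (Nat.le_succ r)).contDiff.contDiffAt
  have h3 : ContDiffAt ℝ ∞ (fun η : Jet m (r + 1) => ((1, 0) : Jet m r) + shiftL (E m) r η) ξ :=
    contDiffAt_const.add (shiftL (E m) r).contDiff.contDiffAt
  have h4 := h2.clm_apply h3
  refine h4.congr_of_eventuallyEq (Filter.Eventually.of_forall fun η => ?_)
  unfold totalDeriv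
  rw [shift_eq]
  rfl

/-- Varying only the highest derivative fixes the base jet and moves the shifted vector linearly, so
`totalDeriv f` is affine along such lines. The top coefficient thus passes unchanged to the next
order. -/
theorem fderiv_totalDeriv_single_last {f : Jet m r → ℝ} {ξ : Jet m (r + 1)}
    (hf : ContDiffAt ℝ ∞ f (proj (Nat.le_succ r) ξ)) (v : E m) :
    fderiv ℝ (totalDeriv f) ξ (0, Pi.single (Fin.last (r + 1)) v) =
      fderiv ℝ f (proj (Nat.le_succ r) ξ) (0, Pi.single (Fin.last r) v) := by
  have h1 : HasFDerivAt (totalDeriv f) (fderiv ℝ (totalDeriv f) ξ) ξ :=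
    ((contDiffAt_totalDeriv hf).differentiableAt (by simp)).hasFDerivAt
  have h2 := h1.hasLineDerivAt (0, Pi.single (Fin.last (r + 1)) v)
  refine h2.unique ?_
  unfold HasLineDerivAt
  have h3 : (fun s : ℝ => totalDeriv f (ξ + s • (0, Pi.single (Fin.last (r + 1)) v))) =
      fun s : ℝ => totalDeriv f ξ +
        s * fderiv ℝ f (proj (Nat.le_succ r) ξ) (0, Pi.single (Fin.last r) v) := by
    funext s
    unfold totalDeriv
    rw [shift_eq, shift_eq, proj_eq_projL, proj_eq_projL, projL_add_smul_single_last,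
      shiftL_add_smul_single_last, ← add_assoc]
    generalize fderiv ℝ f (projL (E m) (Nat.le_succ r) ξ) = φ
    rw [φ.map_add, φ.map_smul, smul_eq_mul]
  rw [h3]
  simpa using ((hasDerivAt_id (0 : ℝ)).mul_const
    (fderiv ℝ f (proj (Nat.le_succ r) ξ) (0, Pi.single (Fin.last r) v))).const_add
      (totalDeriv f ξ)

/-- Total differentiation commutes with pullback along jet projections, by the chain rule. The
agreement is required only near one jet, as the formula for `curvatureFun` is available only over
Frenet jets. -/
theorem totalDeriv_of_eventuallyEq {f : Jet m r → ℝ} {g : Jet m l → ℝ} (h : l ≤ r)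
    {η : Jet m (r + 1)}
    (hg : DifferentiableAt ℝ g (proj (Nat.le_succ l) (proj (Nat.succ_le_succ h) η)))
    (hfg : f =ᶠ[nhds (proj (Nat.le_succ r) η)] fun ξ => g (proj h ξ)) :
    totalDeriv f η = totalDeriv g (proj (Nat.succ_le_succ h) η) := by
  unfold totalDeriv
  rw [hfg.fderiv_eq]
  have h1 : HasFDerivAt (fun ξ : Jet m r => g (proj h ξ)) ((fderiv ℝ g
      (proj (Nat.le_succ l) (proj (Nat.succ_le_succ h) η))).comp (projL (E m) h))
      (proj (Nat.le_succ r) η) :=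
    HasFDerivAt.comp (proj (Nat.le_succ r) η) (f := projL (E m) h) hg.hasFDerivAt
      (projL (E m) h).hasFDerivAt
  rw [h1.fderiv]
  rfl

/-- The shifted vector starts at `x_1`, so a translation does not affect it and the linear part of
the action carries it to the shifted vector of the image jet. -/
theorem totalDeriv_affineAct {f : Jet m r → ℝ} (L : E m →L[ℝ] E m) (c : E m) {ξ : Jet m (r + 1)}
    (hf : DifferentiableAt ℝ f (affineAct L c (proj (Nat.le_succ r) ξ)))
    (hinv : (fun η => f (affineAct L c η)) =ᶠ[nhds (proj (Nat.le_succ r) ξ)] f) :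
    totalDeriv f (affineAct L c ξ) = totalDeriv f ξ := by
  unfold totalDeriv
  have h1 := hf.hasFDerivAt.comp (proj (Nat.le_succ r) ξ) (hasFDerivAt_affineAct L c _)
  rw [← hinv.fderiv_eq, show fderiv ℝ (fun η => f (affineAct L c η)) (proj (Nat.le_succ r) ξ) = _
    from h1.fderiv, ContinuousLinearMap.comp_apply, linearAct_shift L c ξ]
  rw [proj_eq_projL, projL_affineAct]
  rfl

end TotalDerivative

section IteratedTotalDerivative

variable {l d : ℕ}

theorem contDiffAt_iterTotalDeriv (hd : d ≤ r) {f : Jet m r → ℝ}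
    (hf : ∀ ξ, DerivIndependent d ξ → ContDiffAt ℝ ∞ f ξ) (h : ℕ) {ξ : Jet m (r + h)}
    (hξ : DerivIndependent d ξ) : ContDiffAt ℝ ∞ (iterTotalDeriv f h) ξ := by
  induction h with
  | zero => exact hf ξ hξ
  | succ h ih =>
    exact contDiffAt_totalDeriv (ih ((derivIndependent_proj (by omega) _).2 hξ))

theorem iterTotalDeriv_affineAct (hd : d ≤ r) {f : Jet m r → ℝ}
    (hf : ∀ ξ, DerivIndependent d ξ → ContDiffAt ℝ ∞ f ξ) {L : E m →L[ℝ] E m}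
    (hL : Function.Injective L) (c : E m)
    (hinv : ∀ ξ, DerivIndependent d ξ → f (affineAct L c ξ) = f ξ) (h : ℕ) {ξ : Jet m (r + h)}
    (hξ : DerivIndependent d ξ) :
    iterTotalDeriv f h (affineAct L c ξ) = iterTotalDeriv f h ξ := by
  induction h with
  | zero => exact hinv ξ hξ
  | succ h ih =>
    have h1 : DerivIndependent d (proj (Nat.le_succ (r + h)) ξ) :=
      (derivIndependent_proj (by omega) _).2 hξ
    refine totalDeriv_affineAct L c ((contDiffAt_iterTotalDeriv hd hf h
      (derivIndependent_affineAct hL c h1)).differentiableAt (by simp)) ?_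
    filter_upwards [(isOpen_derivIndependent d).mem_nhds h1] with η hη
    exact ih hη

theorem fderiv_iterTotalDeriv_single_last (hd : d ≤ r) {f : Jet m r → ℝ}
    (hf : ∀ ξ, DerivIndependent d ξ → ContDiffAt ℝ ∞ f ξ) (h : ℕ) {ξ : Jet m (r + h)}
    (hξ : DerivIndependent d ξ) (v : E m) :
    fderiv ℝ (iterTotalDeriv f h) ξ (0, Pi.single (Fin.last (r + h)) v) =
      fderiv ℝ f (proj (Nat.le_add_right r h) ξ) (0, Pi.single (Fin.last r) v) := by
  induction h with
  | zero => rfl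
  | succ h ih =>
    have h1 : DerivIndependent d (proj (Nat.le_succ (r + h)) ξ) :=
      (derivIndependent_proj (by omega) _).2 hξ
    exact (fderiv_totalDeriv_single_last (contDiffAt_iterTotalDeriv hd hf h h1) v).trans (ih h1)

/-- This lowers the order: the `h`-th total derivative of a function on `J^m` that comes from
`J^{i+1}` lives on `J^{i+1+h}` instead of `J^{m+h}`. -/
theorem iterTotalDeriv_eq_of_eq_proj {d' : ℕ} (hd : d ≤ r) (hl : l ≤ r) (hd' : d' ≤ l)
    (hdd : d' ≤ d) {f : Jet m r → ℝ} {g : Jet m l → ℝ}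
    (hg : ∀ ξ, DerivIndependent d' ξ → ContDiffAt ℝ ∞ g ξ)
    (hfg : ∀ ξ, DerivIndependent d ξ → f ξ = g (proj hl ξ)) (h : ℕ) {ξ : Jet m (r + h)}
    (hξ : DerivIndependent d ξ) :
    iterTotalDeriv f h ξ = iterTotalDeriv g h (proj (Nat.add_le_add_right hl h) ξ) := by
  induction h with
  | zero => exact hfg ξ hξ
  | succ h ih =>
    refine totalDeriv_of_eventuallyEq (Nat.add_le_add_right hl h)
      ((contDiffAt_iterTotalDeriv hd' hg h ?_).differentiableAt (by simp)) ?_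
    · exact (derivIndependent_proj (by omega) _).2 ((derivIndependent_proj (by omega) _).2
        (hξ.mono hdd))
    · filter_upwards [(isOpen_derivIndependent d).mem_nhds
        ((derivIndependent_proj (l := r + h) (by omega) (Nat.le_succ (r + h))).2 hξ)] with η hη
      exact ih hη

end IteratedTotalDerivative

/-! ### The invariants `D_t^h ϰ_i` form a basis -/

section Invariants

/-- The curvature `ϰ_i` as a function on the jets of order `i + 1`. -/
def kapJet (m i : ℕ) (ξ : Jet m (i + 1)) : ℝ := kap (stdB m) (fun j => coord ξ (j + 1)) i

variable {i : ℕ}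

theorem contDiffAt_kapJet (hi : i < m) (ξ : Jet m (i + 1))
    (hξ : DerivIndependent (min (i + 1) (m - 1)) ξ) : ContDiffAt ℝ ∞ (kapJet m i) ξ :=
  contDiffAt_kap (stdB m) (x := fun (ξ : Jet m (i + 1)) j => coord ξ (j + 1))
    (fun _ _ => (contDiff_coord _).contDiffAt) hi hξ

theorem kapJet_affineAct (hi : i < m) {L : E m →L[ℝ] E m}
    (hL : ∀ u v, inner ℝ (L u) (L v) = inner ℝ u v) (hdet : LinearMap.det L.toLinearMap = 1)
    (c : E m) (ξ : Jet m (i + 1)) : kapJet m i (affineAct L c ξ) = kapJet m i ξ := by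
  unfold kapJet
  have h : (fun j => coord (affineAct L c ξ) (j + 1)) = fun j => L (coord ξ (j + 1)) :=
    funext fun j => coord_affineAct_succ L c ξ j
  rw [h]
  exact kap_map (stdB m) hL hdet (fun j => coord ξ (j + 1)) hi

theorem exists_fderiv_kapJet_single_last (hi : i < m) (ξ : Jet m (i + 1))
    (hξ : DerivIndependent (min (i + 1) (m - 1)) ξ) :
    ∃ c : ℝ, c ≠ 0 ∧ ∀ v, fderiv ℝ (kapJet m i) ξ (0, Pi.single (Fin.last (i + 1)) v) =
      c * inner ℝ (frame (stdB m) (fun j => coord ξ (j + 1)) i) v := by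
  obtain ⟨c, hc, h⟩ := exists_hasDerivAt_kap_update (stdB m) (x := fun j => coord ξ (j + 1)) hi hξ
  refine ⟨c, hc, fun v => ?_⟩
  have h1 := (((contDiffAt_kapJet hi ξ hξ).differentiableAt (by simp)).hasFDerivAt).hasLineDerivAt
    (0, Pi.single (Fin.last (i + 1)) v)
  refine h1.unique ?_
  have h2 : ∀ s : ℝ, (fun j => coord (ξ + s • ((0, Pi.single (Fin.last (i + 1)) v) :
      Jet m (i + 1))) (j + 1)) =
      Function.update (fun j => coord ξ (j + 1)) i (coord ξ (i + 1) + s • v) := ?_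
  · unfold HasLineDerivAt kapJet
    simp only [h2]
    exact h v
  intro s
  funext j
  rw [← coordL_apply, map_add, map_smul, coordL_apply, coordL_apply, coord_single]
  by_cases hj : j = i
  · subst hj
    rw [Function.update_self, Fin.val_last, if_pos rfl]
  · rw [Function.update_of_ne hj, Fin.val_last, if_neg (by omega), smul_zero, add_zero]

/-- The function `D_t^h ϰ_i`, `h + i ≤ m - 1`, on the jets of order `m`. -/
def curvatureInvariant (p : InvariantIndex m) (ξ : Jet m m) : ℝ :=
  iterTotalDeriv (kapJet m p.1.2) (p.1.1 : ℕ)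
    (proj (show (p.1.2 : ℕ) + 1 + p.1.1 ≤ m by
      have := p.2; have := p.1.1.isLt; omega) ξ)

theorem iterTotalDeriv_curvatureFun (hm : 2 ≤ m) (p : InvariantIndex m)
    {η : Jet m (m + (p.1.1 : ℕ))} (hη : DerivIndependent (m - 1) η) :
    iterTotalDeriv (curvatureFun m (p.1.2 : ℕ)) (p.1.1 : ℕ) η =
      curvatureInvariant p (proj (Nat.le_add_right m (p.1.1 : ℕ)) η) := by
  have hi := p.1.2.isLt
  refine iterTotalDeriv_eq_of_eq_proj (d := m - 1) (d' := min ((p.1.2 : ℕ) + 1) (m - 1))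
    (g := kapJet m p.1.2) (by omega) (show (p.1.2 : ℕ) + 1 ≤ m by omega) (by omega) (by omega)
    (contDiffAt_kapJet hi) (fun ξ hξ => ?_) _ hη
  rw [curvatureFun_eq_kap hm hξ hi]
  exact kap_congr (stdB m) hi fun j hj => (coord_proj _ ξ (by omega)).symm

theorem contDiffAt_curvatureInvariant (p : InvariantIndex m) {ξ : Jet m m}
    (hξ : DerivIndependent (m - 1) ξ) : ContDiffAt ℝ ∞ (curvatureInvariant p) ξ := by
  have hi := p.1.2.isLt
  have hle : (p.1.2 : ℕ) + 1 + p.1.1 ≤ m := by have := p.2; omega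
  have h1 : DerivIndependent (min ((p.1.2 : ℕ) + 1) (m - 1)) (proj hle ξ) :=
    (derivIndependent_proj (by omega) hle).2 (hξ.mono (by omega))
  exact (contDiffAt_iterTotalDeriv (by omega) (contDiffAt_kapJet hi) _ h1).comp ξ
    (f := projL (E m) hle) (projL (E m) hle).contDiff.contDiffAt

theorem curvatureInvariant_affineAct (p : InvariantIndex m) {L : E m →L[ℝ] E m}
    (hL : ∀ u v, inner ℝ (L u) (L v) = inner ℝ u v) (hdet : LinearMap.det L.toLinearMap = 1)
    (c : E m) {ξ : Jet m m} (hξ : DerivIndependent (m - 1) ξ) :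
    curvatureInvariant p (affineAct L c ξ) = curvatureInvariant p ξ := by
  have hi := p.1.2.isLt
  have hle : (p.1.2 : ℕ) + 1 + p.1.1 ≤ m := by have := p.2; omega
  have h1 : DerivIndependent (min ((p.1.2 : ℕ) + 1) (m - 1)) (proj hle ξ) :=
    (derivIndependent_proj (by omega) hle).2 (hξ.mono (by omega))
  have hinj : Function.Injective L := by
    intro x y hxy
    have h := hL (x - y) (x - y)
    rw [map_sub, hxy, sub_self, inner_zero_left] at h
    exact sub_eq_zero.1 (inner_self_eq_zero.1 h.symm)
  have h2 : proj hle (affineAct L c ξ) = affineAct L c (proj hle ξ) := projL_affineAct hle L c ξ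
  unfold curvatureInvariant
  rw [h2]
  exact iterTotalDeriv_affineAct (by omega) (contDiffAt_kapJet hi) hinj c
    (fun ζ _ => kapJet_affineAct hi hL hdet c ζ) _ h1

theorem fderiv_curvatureInvariant_killing (p : InvariantIndex m) {ξ : Jet m m}
    (hξ : DerivIndependent (m - 1) ξ) {V : Jet m m} (hV : V ∈ killingDistribution ξ) :
    fderiv ℝ (curvatureInvariant p) ξ V = 0 :=
  fderiv_apply_of_mem_killingDistribution
    ((contDiffAt_curvatureInvariant p hξ).differentiableAt (by simp))
    (fun b => curvatureInvariant_affineAct p (fun _ _ => rfl) LinearMap.det_id b hξ)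
    (fun _ hA s => curvatureInvariant_affineAct p (inner_exp_smul_apply hA s)
      (det_exp_smul hA s) 0 hξ) hV

theorem fderiv_curvatureInvariant (p : InvariantIndex m) {ξ : Jet m m}
    (hξ : DerivIndependent (m - 1) ξ) (hle : (p.1.2 : ℕ) + 1 + p.1.1 ≤ m) :
    fderiv ℝ (curvatureInvariant p) ξ =
      (fderiv ℝ (iterTotalDeriv (kapJet m p.1.2) (p.1.1 : ℕ)) (projL (E m) hle ξ)).comp
        (projL (E m) hle) := by
  have hi := p.1.2.isLt
  have h1 : DerivIndependent (min ((p.1.2 : ℕ) + 1) (m - 1)) (proj hle ξ) :=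
    (derivIndependent_proj (by omega) hle).2 (hξ.mono (by omega))
  exact (((contDiffAt_iterTotalDeriv (by omega) (contDiffAt_kapJet hi) _ h1).differentiableAt
    (by simp)).hasFDerivAt.comp ξ (f := projL (E m) hle) (projL (E m) hle).hasFDerivAt).fderiv

theorem fderiv_curvatureInvariant_single_of_lt (p : InvariantIndex m) {ξ : Jet m m}
    (hξ : DerivIndependent (m - 1) ξ) {k : Fin (m + 1)} (hk : (p.1.2 : ℕ) + 1 + p.1.1 < k)
    (v : E m) : fderiv ℝ (curvatureInvariant p) ξ (0, Pi.single k v) = 0 := by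
  have hle : (p.1.2 : ℕ) + 1 + p.1.1 ≤ m := by have := k.isLt; omega
  rw [fderiv_curvatureInvariant p hξ hle, ContinuousLinearMap.comp_apply, projL_single_of_lt hle hk,
    map_zero]

theorem exists_fderiv_curvatureInvariant_single (p : InvariantIndex m) {ξ : Jet m m}
    (hξ : DerivIndependent (m - 1) ξ) {k : Fin (m + 1)} (hk : (k : ℕ) = (p.1.2 : ℕ) + 1 + p.1.1) :
    ∃ c : ℝ, c ≠ 0 ∧ ∀ v, fderiv ℝ (curvatureInvariant p) ξ (0, Pi.single k v) =
      inner ℝ (c • frame (stdB m) (fun j => coord ξ (j + 1)) p.1.2) v := by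
  have hi := p.1.2.isLt
  have hle : (p.1.2 : ℕ) + 1 + p.1.1 ≤ m := by have := k.isLt; omega
  have h1 : DerivIndependent (min ((p.1.2 : ℕ) + 1) (m - 1)) (proj hle ξ) :=
    (derivIndependent_proj (by omega) hle).2 (hξ.mono (by omega))
  have h2 : DerivIndependent (min ((p.1.2 : ℕ) + 1) (m - 1))
      (proj (Nat.le_add_right ((p.1.2 : ℕ) + 1) p.1.1) (proj hle ξ)) :=
    (derivIndependent_proj (by omega) _).2 h1
  obtain ⟨c, hc, h⟩ := exists_fderiv_kapJet_single_last hi _ h2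
  refine ⟨c, hc, fun v => ?_⟩
  have hk' : k = Fin.castLE (Nat.succ_le_succ hle) (Fin.last _) := Fin.ext hk
  rw [fderiv_curvatureInvariant p hξ hle, ContinuousLinearMap.comp_apply, hk', projL_single hle]
  refine (fderiv_iterTotalDeriv_single_last (by omega) (contDiffAt_kapJet hi) _ h1 v).trans ?_
  rw [h v, real_inner_smul_left]
  congr 2
  refine frame_congr (stdB m) hi fun j hj _ => ?_
  exact (coord_proj _ _ (by omega)).trans (coord_proj _ _ (by omega))

/-- The invariants `t` and `D_t^h ϰ_i`, `h + i ≤ m - 1`. -/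
def curvatureFamily (m : ℕ) (a : Option (InvariantIndex m)) (ξ : Jet m m) : ℝ :=
  a.elim ξ.1 fun p => curvatureInvariant p ξ

/-- The top coefficient of `D_t^h ϰ_i`, at order `h + i + 1`, is a nonzero multiple of the frame
vector with index `i`. At a fixed order `i` determines `h`, so these vectors are distinct members of
an orthonormal frame. -/
theorem linearIndependent_fderiv_curvatureFamily {ξ : Jet m m} (hξ : DerivIndependent (m - 1) ξ) :
    LinearIndependent ℝ (fun a => fderiv ℝ (curvatureFamily m a) ξ) := by
  let o : InvariantIndex m → Fin (m + 1) := fun p =>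
    ⟨(p.1.2 : ℕ) + 1 + p.1.1, by have := p.2; have := p.1.1.isLt; omega⟩
  choose c hc h2 using fun p : InvariantIndex m =>
    exists_fderiv_curvatureInvariant_single p hξ (k := o p) rfl
  have hind := linearIndependent_of_top_order
    (fun p : InvariantIndex m => fderiv ℝ (curvatureInvariant p) ξ) o _
    (fun p k v hk => fderiv_curvatureInvariant_single_of_lt p hξ hk v) h2 (fun k => ?_)
  · convert hind using 1
    funext a
    cases a with
    | none => exact (ContinuousLinearMap.fst ℝ ℝ (Fin (m + 1) → E m)).fderiv
    | some p => rfl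
  · have h3 : LinearIndependent ℝ (fun p : {p : InvariantIndex m // o p = k} =>
        frame (stdB m) (fun j => coord ξ (j + 1)) (p : InvariantIndex m).1.2) := by
      refine (orthonormal_frame (stdB m) (x := fun j => coord ξ (j + 1)) hξ).linearIndependent.comp
        (fun p : {p : InvariantIndex m // o p = k} => (p : InvariantIndex m).1.2) ?_
      rintro ⟨⟨⟨a, b⟩, hp⟩, hp'⟩ ⟨⟨⟨a', b'⟩, hq⟩, hq'⟩ e
      have e1 := congrArg Fin.val (hp'.trans hq'.symm)
      have e2 := congrArg Fin.val e
      simp only [o] at e1 e2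
      have e3 : a = a' := Fin.ext (by omega)
      have e4 : b = b' := e
      subst e3 e4
      rfl
    exact h3.units_smul fun p => Units.mk0 (c p) (hc p)

/-- Reversing `i` turns `h + i ≤ m - 1` into `h ≤ m - 1 - i`, the condition defining `GramIndex m
m`. -/
theorem card_invariantIndex_add (m : ℕ) :
    Fintype.card (InvariantIndex m) + Fintype.card (SkewIndex m (min m (m - 1))) = m * m := by
  have e : InvariantIndex m ≃ GramIndex m m :=
    { toFun := fun p => ⟨(p.1.1, p.1.2.rev), by
        have h := p.2; have h1 := p.1.2.isLt; simp only [Fin.val_rev]; omega⟩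
      invFun := fun p => ⟨(p.1.1, p.1.2.rev), by
        have h := p.2; have h1 := p.1.2.isLt; simp only [Fin.val_rev]; omega⟩
      left_inv := fun p => Subtype.ext (Prod.ext rfl (Fin.rev_rev _))
      right_inv := fun p => Subtype.ext (Prod.ext rfl (Fin.rev_rev _)) }
  rw [Fintype.card_congr e, card_gramIndex_add]

theorem isDifferentialInvariantOn_curvatureFamily (a : Option (InvariantIndex m)) :
    IsDifferentialInvariantOn {ξ | DerivIndependent (m - 1) ξ} (curvatureFamily m a) := by
  cases a with
  | none => exact isDifferentialInvariantOn_fst _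
  | some p => exact ⟨fun ξ hξ => (contDiffAt_curvatureInvariant p hξ).contDiffWithinAt,
      fun ξ hξ V hV => fderiv_curvatureInvariant_killing p hξ hV⟩

/-- `D` lies in the common kernel, whose dimension is at most that of `D`, so the two coincide. -/
theorem mem_of_linearIndependent_functionals {V ι : Type*} [NormedAddCommGroup V] [NormedSpace ℝ V]
    [FiniteDimensional ℝ V] [Fintype ι] {φ : ι → (V →L[ℝ] ℝ)} (h : LinearIndependent ℝ φ)
    {D : Submodule ℝ V} (hD : ∀ i, ∀ v ∈ D, φ i v = 0)
    (hdim : Module.finrank ℝ V ≤ Fintype.card ι + Module.finrank ℝ D) {v : V}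
    (hv : ∀ i, φ i v = 0) : v ∈ D := by
  have h1 := card_add_finrank_le h (⨅ i, LinearMap.ker (φ i : V →ₗ[ℝ] ℝ)) fun i v hv =>
    (Submodule.mem_iInf _).1 hv i
  have h2 : D ≤ ⨅ i, LinearMap.ker (φ i : V →ₗ[ℝ] ℝ) := fun v hv =>
    (Submodule.mem_iInf _).2 fun i => hD i v hv
  rw [Submodule.eq_of_le_of_finrank_le h2 (by omega)]
  exact (Submodule.mem_iInf _).2 hv

/-- As the family has codimension-many members, a vector killed by all their differentials lies in
the Killing distribution. Every invariant therefore satisfies the hypothesis of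
`exists_local_factorization`. -/
theorem isBasisOfInvariantsOn_curvatureFamily (m : ℕ) :
    IsBasisOfInvariantsOn {ξ : Jet m m | DerivIndependent (m - 1) ξ} (curvatureFamily m) := by
  refine ⟨isDifferentialInvariantOn_curvatureFamily,
    fun ξ hξ => linearIndependent_fderiv_curvatureFamily hξ, fun ξ hξ U hU hξU => ?_⟩
  obtain ⟨N, hN, hξN, hNU, h⟩ := exists_local_factorization (isOpen_derivIndependent (m - 1))
    (fun a => (isDifferentialInvariantOn_curvatureFamily (m := m) a).1)
    (fun ξ hξ => linearIndependent_fderiv_curvatureFamily hξ) hξ hU hξU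
  refine ⟨N, hN, hξN, hNU, fun f hf => h f hf.1 fun η hη v hv => hf.2 η hη v ?_⟩
  have hη' : DerivIndependent (m - 1) η := (hNU hη).2
  refine mem_of_linearIndependent_functionals (linearIndependent_fderiv_curvatureFamily hη')
    (fun a => (isDifferentialInvariantOn_curvatureFamily a).2 η hη') ?_ hv
  have h1 := card_invariantIndex_add m
  rw [finrank_jet, finrank_killingDistribution η (hη'.mono (min_le_right _ _)),
    Fintype.card_option, Nat.add_mul]
  omega

theorem frenetJets_eq (m k : ℕ) (h : m ≤ k + 1) :
    frenetJets m k h = {ξ | DerivIndependent (m - 1) ξ} := by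
  ext ξ
  have e : (fun i : Fin (m - 1) => coord ξ ((i : ℕ) + 1)) =
      fun i : Fin (m - 1) => ξ.2 ⟨(i : ℕ) + 1, by have := i.isLt; omega⟩ :=
    funext fun i => coord_of_le _ (by have := i.isLt; omega)
  change LinearIndependent ℝ _ ↔ LinearIndependent ℝ _
  rw [e]

end Invariants

end EuclideanJets

end

/-! ### Assembly and arithmetic of the dimension formulas -/

open EuclideanJets in
theorem mainTheorem11 (m : ℕ) (hm : 2 ≤ m) :
    -- the rank of the distribution at the `r`-jets of curves with a Frenet jet
    (∀ (σ : ℝ → E m) (a b t₀ : ℝ), t₀ ∈ Set.Ioo a b → ContDiffOn ℝ ∞ σ (Set.Ioo a b) →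
      IsFrenetAt σ t₀ → ∀ r : ℕ, 1 ≤ r →
        (r ≤ m - 1 →
          (Module.finrank ℝ (killingDistribution (jet r σ t₀)) : ℝ) =
            m + 1 / 2 * (2 * m - r - 1) * r) ∧
        (m ≤ r →
          Module.finrank ℝ (killingDistribution (jet r σ t₀)) = m + m.choose 2)) ∧
    -- the number of functionally independent differential invariants
    (∀ r : ℕ, 1 ≤ r → ∃ N : ℕ, IsNumberOfInvariants m r N ∧
      (r ≤ m - 1 → N = 1 + (r + 1).choose 2) ∧
      (m ≤ r → (N : ℝ) = 1 + 1 / 2 * m * (2 * r - m + 1))) ∧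
    -- `D_t^h ϰ_i` is of order at most `m` for `h + i ≤ m - 1`, and together with `t`
    -- these functions form a basis of the differential invariants of order at most `m`
    (∃ I : InvariantIndex m → Jet m m → ℝ,
      (∀ (p : InvariantIndex m),
        ∀ η ∈ frenetJets m (m + (p.1.1 : ℕ)) (by omega),
          iterTotalDeriv (curvatureFun m (p.1.2 : ℕ)) (p.1.1 : ℕ) η =
            I p (proj (Nat.le_add_right m (p.1.1 : ℕ)) η)) ∧
      IsBasisOfInvariantsOn (frenetJets m m (Nat.le_succ m))
        (fun a : Option (InvariantIndex m) => fun ξ : Jet m m =>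
          a.elim ξ.1 (fun p => I p ξ))) := by
  refine ⟨fun σ a b t₀ _ _ hσ r hr => ?_, fun r hr => ⟨_, isNumberOfInvariants_card m r, ?_⟩,
    curvatureInvariant, fun p η hη => ?_, ?_⟩
  · rw [finrank_killingDistribution _ (derivIndependent_jet hσ)]
    refine ⟨fun h => ?_, fun h => ?_⟩
    · rw [min_eq_left h]
      have h1 : (2 * Fintype.card (SkewIndex m r) + r * (r + 1) : ℝ) = 2 * m * r := by
        exact_mod_cast two_mul_card_skewIndex (m := m) (d := r) (by omega)
      push_cast
      linarith
    -- For `r ≥ m` the relevant number of derivatives is `m - 1`; writing it as `n` removes the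
    -- truncated subtraction.
    · obtain ⟨n, rfl⟩ : ∃ n, m = n + 1 := ⟨m - 1, by omega⟩
      have h1 := two_mul_card_skewIndex (m := n + 1) (d := n) (by omega)
      rw [Nat.add_sub_cancel, min_eq_right (by omega), Nat.choose_two_right, Nat.add_sub_cancel]
      congr 1
      refine (Nat.div_eq_of_eq_mul_right two_pos ?_).symm
      linarith
  · have h0 := card_gramIndex_add m r
    refine ⟨fun h => ?_, fun h => ?_⟩
    · rw [min_eq_left h] at h0
      have h1 := two_mul_card_skewIndex (m := m) (d := r) (by omega)
      rw [Nat.choose_two_right, Nat.add_sub_cancel, add_comm]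
      congr 1
      refine (Nat.div_eq_of_eq_mul_right two_pos ?_).symm
      linarith
    · obtain ⟨n, rfl⟩ : ∃ n, m = n + 1 := ⟨m - 1, by omega⟩
      rw [Nat.add_sub_cancel, min_eq_right (by omega)] at h0
      have h1 := two_mul_card_skewIndex (m := n + 1) (d := n) (by omega)
      have h0' : (Fintype.card (GramIndex (n + 1) r) + Fintype.card (SkewIndex (n + 1) n) : ℝ) =
        (n + 1) * r := by exact_mod_cast h0
      have h1' : (2 * Fintype.card (SkewIndex (n + 1) n) + n * (n + 1) : ℝ) =
        2 * (n + 1) * n := by exact_mod_cast h1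
      push_cast
      linarith
  · rw [frenetJets_eq] at hη
    exact iterTotalDeriv_curvatureFun hm p hη
  · rw [frenetJets_eq]
    exact isBasisOfInvariantsOn_curvatureFamily m
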